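/- **Setting.** Let $d,K,Q\ge 1$. Device $k\in\{1,\dots,K\}$ holds a finite non-empty dataset $\mathcal D_k$; with a per-sample loss $\mathcal L(\theta;\xi)$, $\theta\in\mathbb R^d$, put $f_k(\theta)=\frac1{|\mathcal D_k|}\sum_{\xi\in\mathcal D_k}\mathcal L(\theta;\xi)$ and $f=\frac1K\sum_k f_k$. Assume $f$ is bounded below and let $f^*=\inf f$. For a non-empty mini-batch $b\subseteq\mathcal D_k$ let $\hat\nabla f_k(\theta)=\frac1{|b|}\sum_{\xi\in b}\nabla\mathcal L(\theta;\xi)$. Each device has a power budget $P_k>0$, a large-scale gain $\kappa_k>0$ and a threshold $\varepsilon_k>0$. **AirFL-Mem** with constant step size $\eta>0$. Start from a fixed $\theta^{(0)}$ and $m_k^{(0)}=0$. In round $t=0,1,\dots$, device $k$ sets $\theta_k^{(t,0)}=\theta^{(t)}$, runs $\theta_k^{(t,q+1)}=\theta_k^{(t,q)}-\eta\hat\nabla f_k(\theta_k^{(t,q)})$ for $q=0,\dots,Q-1$, and sets $\Delta_k^{(t)}=\theta_k^{(t,0)}-\theta_k^{(t,Q)}$. With the mask $q_{k,j}^{(t)}=1$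 if $|h_{k,j}^{(t)}|^2\ge\varepsilon_k$ and $0$ otherwise, it forms $x_k^{(t)}=(m_k^{(t)}+\Delta_k^{(t)})/\eta$ and $m_k^{(t+1)}=m_k^{(t)}+\Delta_k^{(t)}-q_k^{(t)}\odot(m_k^{(t)}+\Delta_k^{(t)})$. The server receives $$y_j^{(t)}=\sum_k\sqrt{\kappa_k}\,h_{k,j}^{(t)}p_{k,j}^{(t)}q_{k,j}^{(t)}x_{k,j}^{(t)}+n_j^{(t)},\qquad p_{k,j}^{(t)}=\frac{\sqrt{\rho^{(t)}}}{\sqrt{\kappa_k}\,h_{k,j}^{(t)}},$$ and sets $\theta^{(t+1)}=\theta^{(t)}-\frac{\eta}{\sqrt{\rho^{(t)}}K}y^{(t)}$. In every round $t<T$, $\rho^{(t)}>0$ is the largest (deterministic) value for which $\frac1d\mathbb E\|p_k^{(t)}\odot q_k^{(t)}\odot x_k^{(t)}\|^2\le P_k$ for all $k$ (in particular, a largest value is assumed to exist). **Randomness.** The mini-batches of all rounds, devices and local steps are independent. The complex fading vectors $(h_{k,j}^{(t)})_{k}$ are independent over rounds $t$ and entries $j$, and for each $k$ the law of $h_{k,j}^{(t)}$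 is a fixed law, the same for all $t,j$. The noise entries $n_j^{(t)}$ are i.i.d. $\mathcal N(0,\sigma^2)$, $\sigma\ge 0$. Mini-batches, fading and noise are independent of each other. Let $\lambda_k=\Pr(|h_{k,j}^{(t)}|^2\ge\varepsilon_k)$ be the transmission probability, and assume $\lambda_k>0$. **Assumptions.** For all $k$ and all $\theta,w,u\in\mathbb R^d$: 1. $f_k$ is differentiable and $\|\nabla f_k(w)-\nabla f_k(u)\|\le L_k\|w-u\|$; 2. for every mini-batch of device $k$, $\mathbb E\hat\nabla f_k(\theta)=\nabla f_k(\theta)$, $\mathbb E\|\hat\nabla f_k(\theta)-\nabla f_k(\theta)\|^2\le\sigma_l^2$ and $\mathbb E\|\hat\nabla f_k(\theta)\|^2\le B_k^2$, where $B_k\ge0$; 3. $\|\nabla f_k(\theta)-\nabla f(\theta)\|^2\le\sigma_g^2$. Put $L=\max_kL_k$, $B=\max_kB_k$, $C_\lambda=\frac{4(1-\lambda^2)}{\lambda^2}$ and $\tilde C_\lambda=C_\lambda+1$. **Theorem.** (i) If $\eta>0$ satisfies $$45\eta^3L^3Q^3+30\eta^2Q^2L^2+\tfrac32\eta QL\le\tfrac18,\qquad(*)$$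 then for every $T\ge1$ the expectations below are finite and $$\begin{aligned}\frac1T\sum_{t=0}^{T-1}\mathbb E\|\nabla f(\theta^{(t)})\|^2\le{}&\frac{8}{\eta QT}\bigl[f(\theta^{(0)})-f^*\bigr]+\frac{12}{K}\sum_{k=1}^K\eta^2B^2Q^2L^2C_{\lambda_k}+\frac{8\eta L\sigma^2}{K^2}\max_{k}\frac{\lambda_kB^2Q\tilde C_{\lambda_k}}{P_k\kappa_k\varepsilon_k}\\&+(40\eta^2QL^2+60\eta^3Q^2L^3)(\sigma_l^2+6Q\sigma_g^2)+12\eta QL\sigma_l^2.\end{aligned}$$ (ii) There are constants $C$ and $T_0$, which depend on the data above (the losses, datasets, $Q$, $\theta^{(0)}$, $P_k,\kappa_k,\varepsilon_k$, the fading laws, $\sigma$, $L_k,B_k,\sigma_l,\sigma_g$) but not on $T$ nor on the execution, such that for all $T\ge\max(T_0,1)$ the step size $\eta=1/\sqrt T$ satisfies $(*)$ and every execution with this step size satisfies $$\frac1T\sum_{t=0}^{T-1}\mathbb E\|\nabla f(\theta^{(t)})\|^2\le\frac{C}{\sqrt T}.$$ -/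

import Mathlib

open MeasureTheory ProbabilityTheory
open scoped NNReal Gradient

noncomputable section

namespace AirFL

/-- Model parameters `θ ∈ ℝ^d` with the Euclidean norm. -/
abbrev Param (d : ℕ) := EuclideanSpace ℝ (Fin d)

/-- The learning task and the wireless system: `K` devices, parameters in `ℝ^d`,
data samples of type `Ξ`. -/
structure System (d K : ℕ) (Ξ : Type*) where
  /-- the per-sample loss `ℒ(θ; ξ)` -/
  loss : Param d → Ξ → ℝ
  /-- the local datasets `𝒟_k` -/
  data : Fin K → Finset Ξ
  data_nonempty : ∀ k, (data k).Nonempty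
  /-- the number of local SGD steps per round -/
  Q : ℕ
  /-- the initial model `θ^(0)` -/
  θ₀ : Param d
  /-- the power budgets `P_k` -/
  P : Fin K → ℝ
  P_pos : ∀ k, 0 < P k
  /-- the large-scale channel gains `κ_k` -/
  κ : Fin K → ℝ
  κ_pos : ∀ k, 0 < κ k
  /-- the truncation thresholds `ε_k` -/
  ε : Fin K → ℝ
  ε_pos : ∀ k, 0 < ε k
  /-- the law of the small-scale fading coefficients of device `k` -/
  fading : Fin K → Measure ℂ
  fading_prob : ∀ k, IsProbabilityMeasure (fading k)
  /-- the standard deviation `σ` of each noise entry -/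
  σ : ℝ≥0

namespace System

variable {d K : ℕ} {Ξ : Type*} (S : System d K Ξ)

/-- `f_k(θ) = |𝒟_k|⁻¹ ∑_{ξ ∈ 𝒟_k} ℒ(θ; ξ)`. -/
def localLoss (k : Fin K) (θ : Param d) : ℝ :=
  ((S.data k).card : ℝ)⁻¹ * ∑ ξ ∈ S.data k, S.loss θ ξ

/-- `f(θ) = K⁻¹ ∑_k f_k(θ)`. -/
def globalLoss (θ : Param d) : ℝ := (K : ℝ)⁻¹ * ∑ k, S.localLoss k θ

/-- The mini-batch gradient `|b|⁻¹ ∑_{ξ ∈ b} ∇ℒ(θ; ξ)`. -/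
def stochGrad (b : Finset Ξ) (θ : Param d) : Param d :=
  (b.card : ℝ)⁻¹ • ∑ ξ ∈ b, gradient (fun w => S.loss w ξ) θ

/-- The transmission probability `λ_k = Pr(|h_k|² ≥ ε_k)`, the probability that an entry of
device `k` is not masked. -/
def transProb (k : Fin K) : ℝ := (S.fading k).real {z : ℂ | S.ε k ≤ ‖z‖ ^ 2}

/-- Each `f_k` is differentiable and `L_k`-smooth. -/
def LSmooth (Lk : Fin K → ℝ) : Prop :=
  ∀ k, Differentiable ℝ (S.localLoss k) ∧
    ∀ w u : Param d, ‖∇ (S.localLoss k) w - ∇ (S.localLoss k) u‖ ≤ Lk k * ‖w - u‖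

/-- `‖∇f_k(θ) - ∇f(θ)‖² ≤ σ_g²` for all `k`, `θ`. -/
def BoundedHeterogeneity (σg : ℝ) : Prop :=
  ∀ k, ∀ θ : Param d, ‖∇ (S.localLoss k) θ - ∇ S.globalLoss θ‖ ^ 2 ≤ σg ^ 2

/-- The local SGD iterates `θ_k^{(t,q)}` of one device within one round, started at `θ`;
`b q` is the mini-batch of step `q`. -/
def localIter (η : ℝ) (b : ℕ → Finset Ξ) (θ : Param d) : ℕ → Param d
  | 0 => θ
  | q + 1 => localIter η b θ q - η • S.stochGrad (b q) (localIter η b θ q)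

/-- The model difference `Δ = θ^{(t,0)} - θ^{(t,Q)}` of one device. -/
def modelDiff (η : ℝ) (b : ℕ → Finset Ξ) (θ : Param d) : Param d :=
  S.localIter η b θ 0 - S.localIter η b θ S.Q

/-- The binary mask of device `k` at fading coefficient `z`. -/
def mask (k : Fin K) (z : ℂ) : ℝ :=
  open scoped Classical in if S.ε k ≤ ‖z‖ ^ 2 then 1 else 0

/-- The power control factor `√r / (√κ_k z)` (channel inversion) for common scaling `r`. -/
def powerFactor (r : ℝ) (k : Fin K) (z : ℂ) : ℂ := (√r : ℂ) / ((√(S.κ k) : ℂ) * z)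

/-- The compensated vector `m + Δ` of one device with memory `m`. -/
def compensated (η : ℝ) (b : ℕ → Finset Ξ) (θ m : Param d) : Param d :=
  m + S.modelDiff η b θ

/-- The signal `x = (m + Δ) / η` of one device. -/
def signal (η : ℝ) (b : ℕ → Finset Ξ) (θ m : Param d) : Param d :=
  η⁻¹ • S.compensated η b θ m

/-- The received vector `y_j = ∑_k √κ_k h_{k,j} p_{k,j} q_{k,j} x_{k,j} + n_j`.
After channel inversion the sum is a real number, which `.re` reads off. -/
def received (r : ℝ) (h : Fin K → Fin d → ℂ) (n : Fin d → ℝ) (x : Fin K → Param d) : Param d :=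
  WithLp.toLp 2 fun j =>
    (∑ k, (√(S.κ k) : ℂ) * h k j * S.powerFactor r k (h k j) *
      (S.mask k (h k j) : ℂ) * (x k j : ℂ)).re + n j

/-- One round of AirFL-Mem, acting on the pair (global model, memories of the devices). -/
def step (η r : ℝ) (b : Fin K → ℕ → Finset Ξ) (h : Fin K → Fin d → ℂ) (n : Fin d → ℝ)
    (s : Param d × (Fin K → Param d)) : Param d × (Fin K → Param d) :=
  (s.1 - (η / (√r * K)) • S.received r h n (fun k => S.signal η (b k) s.1 (s.2 k)),
   fun k => S.compensated η (b k) s.1 (s.2 k) -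
     WithLp.toLp 2 fun j => S.mask k (h k j) * S.compensated η (b k) s.1 (s.2 k) j)

/-- The sources of randomness and the power scalings of an execution of AirFL-Mem. -/
structure Run (S : System d K Ξ) (Ω : Type*) where
  /-- the mini-batch of round `t`, device `k`, local step `q` -/
  batch : ℕ → Fin K → ℕ → Ω → Finset Ξ
  /-- the small-scale fading coefficient `h_{k,j}^{(t)}` -/
  h : ℕ → Fin K → Fin d → Ω → ℂ
  /-- the channel noise `n_j^{(t)}` -/
  n : ℕ → Fin d → Ω → ℝ
  /-- the common power scaling `ρ^{(t)}` -/
  ρ : ℕ → ℝ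

namespace Run

variable {S} {Ω : Type*} (R : S.Run Ω)

/-- The pair `(θ^{(t)}, (m_k^{(t)})_k)` generated by AirFL-Mem with constant step size `η`. -/
def state (η : ℝ) : ℕ → Ω → Param d × (Fin K → Param d)
  | 0, _ => (S.θ₀, 0)
  | t + 1, ω => S.step η (R.ρ t) (fun k q => R.batch t k q ω) (fun k j => R.h t k j ω)
      (fun j => R.n t j ω) (state η t ω)

/-- The global model `θ^{(t)}`. -/
def theta (η : ℝ) (t : ℕ) (ω : Ω) : Param d := (R.state η t ω).1

/-- The long-term memory `m_k^{(t)}`. -/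
def memory (η : ℝ) (t : ℕ) (k : Fin K) (ω : Ω) : Param d := (R.state η t ω).2 k

/-- The signal `x_k^{(t)}` of device `k` in round `t`. -/
def x (η : ℝ) (t : ℕ) (k : Fin K) (ω : Ω) : Param d :=
  S.signal η (fun q => R.batch t k q ω) (R.theta η t ω) (R.memory η t k ω)

variable [MeasurableSpace Ω] (μ : Measure Ω)

/-- The average transmit power `d⁻¹ 𝔼‖p_k ⊙ q_k ⊙ x_k‖²` of device `k` in round `t`
if the common scaling is `r`. -/
def power (η : ℝ) (t : ℕ) (k : Fin K) (r : ℝ) : ℝ :=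
  (d : ℝ)⁻¹ * ∫ ω, ∑ j, ‖S.powerFactor r k (R.h t k j ω) * (S.mask k (R.h t k j ω) : ℂ) *
    (R.x η t k ω j : ℂ)‖ ^ 2 ∂μ

/-- The probabilistic model. Mini-batches are drawn afresh and independently at every local step;
the fading is i.i.d. over rounds and symbols (coefficients of different devices in the same round
and symbol may depend on each other); the noise is i.i.d. Gaussian; mini-batches, fading and
noise are independent of each other. -/
structure IsModel : Prop where
  batch_measurable : ∀ t k q, Measurable (R.batch t k q)
  h_measurable : ∀ t k j, Measurable (R.h t k j)
  n_measurable : ∀ t j, Measurable (R.n t j)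
  batch_nonempty : ∀ t k q ω, (R.batch t k q ω).Nonempty
  batch_subset : ∀ t k q ω, R.batch t k q ω ⊆ S.data k
  batch_indep : iIndepFun (fun (i : ℕ × Fin K × ℕ) ω => R.batch i.1 i.2.1 i.2.2 ω) μ
  h_law : ∀ t k j, μ.map (R.h t k j) = S.fading k
  h_indep : iIndepFun (fun (i : ℕ × Fin d) ω (k : Fin K) => R.h i.1 k i.2 ω) μ
  n_law : ∀ t j, μ.map (R.n t j) = gaussianReal 0 (S.σ ^ 2)
  n_indep : iIndepFun (fun (i : ℕ × Fin d) ω => R.n i.1 i.2 ω) μ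
  batch_indep_h : IndepFun (fun ω (i : ℕ × Fin K × ℕ) => R.batch i.1 i.2.1 i.2.2 ω)
    (fun ω (i : ℕ × Fin K × Fin d) => R.h i.1 i.2.1 i.2.2 ω) μ
  batch_h_indep_n : IndepFun
    (fun ω => ((fun (i : ℕ × Fin K × ℕ) => R.batch i.1 i.2.1 i.2.2 ω),
      (fun (i : ℕ × Fin K × Fin d) => R.h i.1 i.2.1 i.2.2 ω)))
    (fun ω (i : ℕ × Fin d) => R.n i.1 i.2 ω) μ

/-- The stochastic gradients are unbiased, with variance at most `σ_l²` and second moment at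
most `B_k²`, at every fixed `θ`. -/
def BoundedMoments (σl : ℝ) (Bk : Fin K → ℝ) : Prop :=
  ∀ (t : ℕ) (k : Fin K) (q : ℕ) (θ : Param d),
    ∫ ω, S.stochGrad (R.batch t k q ω) θ ∂μ = ∇ (S.localLoss k) θ ∧
    ∫ ω, ‖S.stochGrad (R.batch t k q ω) θ - ∇ (S.localLoss k) θ‖ ^ 2 ∂μ ≤ σl ^ 2 ∧
    ∫ ω, ‖S.stochGrad (R.batch t k q ω) θ‖ ^ 2 ∂μ ≤ Bk k ^ 2

/-- In each of the rounds `0, …, T - 1`, `ρ^{(t)}` is the largest common scaling that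
meets the power constraints of all devices. -/
def PowerControl (η : ℝ) (T : ℕ) : Prop :=
  ∀ t < T, IsGreatest {r : ℝ | 0 < r ∧ ∀ k, R.power μ η t k r ≤ S.P k} (R.ρ t)

/-- `T⁻¹ ∑_{t<T} 𝔼‖∇f(θ^{(t)})‖²`. -/
def avgSqGrad (η : ℝ) (T : ℕ) : ℝ :=
  (T : ℝ)⁻¹ * ∑ t ∈ Finset.range T, ∫ ω, ‖∇ S.globalLoss (R.theta η t ω)‖ ^ 2 ∂μ

end Run

end System

/-- `C_λ = 4 (1 - λ²) / λ²`. -/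
def contractionConst (l : ℝ) : ℝ := 4 * (1 - l ^ 2) / l ^ 2

/-- The step-size condition `45 η³L³Q³ + 30 η²Q²L² + (3/2) ηQL ≤ 1/8`. -/
def StepSizeCondition (η L : ℝ) (Q : ℕ) : Prop :=
  45 * η ^ 3 * L ^ 3 * Q ^ 3 + 30 * η ^ 2 * Q ^ 2 * L ^ 2 + (3 / 2) * η * Q * L ≤ 1 / 8

end AirFL

end

/-!
The proof follows the virtual model `θ^{(t)} - K⁻¹ ∑_k m_k^{(t)}`. Since an entry that is masked
stays in the memory, the masks cancel in its recursion (`virtual_succ`): in every round the virtual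
model moves by minus the plain average of the model differences `Δ_k`, up to the channel noise. It
therefore behaves like a local-SGD iterate, and the descent inequality of the smooth function `f`
applies to it (`descent_step`). Four error terms have to be controlled.

* The distance of the virtual model to `θ^{(t)}` is governed by the memories. Fading is independent
  of the compensated vector `m + Δ`, so `𝔼‖m'‖² = (1 - λ) 𝔼‖m + Δ‖²`; by Young's inequality this is
  a contraction with factor `1 - λ/2`, whose invariant bound is `C_λ (ηQB)²`
  (`integral_norm_memory_sq_le`).
* The channel noise enters with variance proportional to `1/ρ`. Maximality of `ρ` makes the power
  constraint of some device active, and truncation bounds the power of that device by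
  `ρ λ 𝔼‖x‖² / (dκε)` (`exists_div_rho_le`).
* The local drift `𝔼‖θ_k^{(t,q)} - θ^{(t)}‖²` obeys a linear recursion in `q`, in which the
  gradient noise has no cross term (`integral_norm_localTheta_sub_sq_le`).
* The gradient noise in the second-order term is bounded by its variance
  (`integral_norm_avgDelta_sq_le`).

The step size condition is what lets the multiples of `𝔼‖∇f(θ^{(t)})‖²` produced by these estimates
be absorbed, leaving `ηQ/8` of it in each round; summing over the rounds telescopes. For
`η = 1/√T` the remaining terms are at most linear in `η` (`residual_le`).

No regularity of the individual losses is assumed. Measurability of the stochastic gradients is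
free, because a Fréchet derivative is always measurable in the point, and mini-batches are subsets
of a finite dataset. A mini-batch of positive probability has a gradient that is bounded in `θ`, by
the uniform second moment bound, so that all conditional expectations reduce to finite sums
(`integral_comp_of_indep_finite`).
-/

namespace AirFL

/-! ### Independence and finitely valued random variables -/

theorem indep_sup_right_of_indep_sup_left {Ω : Type*} {m₁ m₂ m₃ mΩ : MeasurableSpace Ω}
    {μ : Measure Ω} [IsProbabilityMeasure μ] (h₁ : m₁ ≤ mΩ) (h₂ : m₂ ≤ mΩ) (h₃ : m₃ ≤ mΩ)
    (h₁₂ : Indep m₁ m₂ μ) (h : Indep (m₁ ⊔ m₂) m₃ μ) : Indep m₁ (m₂ ⊔ m₃) μ := by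
  have hpi : IsPiSystem {s | ∃ a b, MeasurableSet[m₂] a ∧ MeasurableSet[m₃] b ∧ s = a ∩ b} := by
    rintro _ ⟨a, b, ha, hb, rfl⟩ _ ⟨a', b', ha', hb', rfl⟩ -
    exact ⟨a ∩ a', b ∩ b', ha.inter ha', hb.inter hb', Set.inter_inter_inter_comm a b a' b'⟩
  have hgen : m₂ ⊔ m₃ = MeasurableSpace.generateFrom
      {s | ∃ a b, MeasurableSet[m₂] a ∧ MeasurableSet[m₃] b ∧ s = a ∩ b} := by
    apply le_antisymm
    · refine sup_le (fun a ha => ?_) (fun b hb => ?_)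
      · exact MeasurableSpace.measurableSet_generateFrom
          ⟨a, Set.univ, ha, MeasurableSet.univ, by simp⟩
      · exact MeasurableSpace.measurableSet_generateFrom
          ⟨Set.univ, b, MeasurableSet.univ, hb, by simp⟩
    · refine MeasurableSpace.generateFrom_le ?_
      rintro _ ⟨a, b, ha, hb, rfl⟩
      exact ((le_sup_left : m₂ ≤ m₂ ⊔ m₃) a ha).inter ((le_sup_right : m₃ ≤ m₂ ⊔ m₃) b hb)
  refine IndepSets.indep (p1 := {s | MeasurableSet[m₁] s}) h₁ (sup_le h₂ h₃)
    (@MeasurableSpace.isPiSystem_measurableSet _ m₁) hpi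
    (@MeasurableSpace.generateFrom_measurableSet _ m₁).symm hgen ?_
  rw [IndepSets_iff]
  rintro c _ hc ⟨a, b, ha, hb, rfl⟩
  rw [Indep_iff] at h₁₂ h
  have e₁ : μ (c ∩ a ∩ b) = μ (c ∩ a) * μ b :=
    h (c ∩ a) b (((le_sup_left : m₁ ≤ m₁ ⊔ m₂) c hc).inter
      ((le_sup_right : m₂ ≤ m₁ ⊔ m₂) a ha)) hb
  have e₂ : μ (a ∩ b) = μ a * μ b := h a b ((le_sup_right : m₂ ≤ m₁ ⊔ m₂) a ha) hb
  rw [← Set.inter_assoc, e₁, e₂, h₁₂ c a hc ha, mul_assoc]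

theorem integral_comp_finite {Ω β E : Type*} [MeasurableSpace Ω] {μ : Measure Ω}
    [IsProbabilityMeasure μ] [NormedAddCommGroup E] [NormedSpace ℝ E] [CompleteSpace E]
    {Y : Ω → β} {s : Finset β} (hYs : ∀ ω, Y ω ∈ s)
    (hY : ∀ b ∈ s, MeasurableSet {ω | Y ω = b}) (W : β → E) :
    Integrable (fun ω => W (Y ω)) μ ∧
      ∫ ω, W (Y ω) ∂μ = ∑ b ∈ s, μ.real {ω | Y ω = b} • W b := by
  classical
  have hsum : (fun ω => W (Y ω)) =
      fun ω => ∑ b ∈ s, {ω | Y ω = b}.indicator (fun _ => W b) ω := by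
    funext ω
    rw [Finset.sum_eq_single_of_mem (Y ω) (hYs ω)]
    · simp
    · intro b _ hb
      simp [Set.indicator, hb.symm]
  have hi : ∀ b ∈ s, Integrable ({ω | Y ω = b}.indicator fun _ => W b) μ := fun b hb =>
    (integrable_const _).indicator (hY b hb)
  rw [hsum]
  refine ⟨integrable_finsetSum _ hi, ?_⟩
  rw [integral_finsetSum _ hi]
  exact Finset.sum_congr rfl fun b hb => integral_indicator_const _ (hY b hb)

/-- Fubini for a finitely valued `Y` independent of the σ-algebra that makes the `Z b` measurable:
`Y` may be replaced by an independent copy, integrated first. -/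
theorem integral_comp_of_indep_finite {Ω β : Type*} {mY m mΩ : MeasurableSpace Ω}
    {μ : Measure Ω} [IsProbabilityMeasure μ] (hmY : mY ≤ mΩ)
    (hind : Indep mY m μ) (Y : Ω → β) (s : Finset β) (hYs : ∀ ω, Y ω ∈ s)
    (hY : ∀ b ∈ s, MeasurableSet[mY] {ω | Y ω = b}) (Z : β → Ω → ℝ)
    (hZ : ∀ b ∈ s, Measurable[m] (Z b))
    (hint : ∀ b ∈ s, μ.real {ω | Y ω = b} ≠ 0 → Integrable (Z b) μ) :
    Integrable (fun ω => Z (Y ω) ω) μ ∧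
      ∫ ω, Z (Y ω) ω ∂μ = ∫ ω, ∫ ω', Z (Y ω') ω ∂μ ∂μ := by
  classical
  set A : β → Set Ω := fun b => {ω | Y ω = b} with hA
  have hAm : ∀ b ∈ s, MeasurableSet (A b) := fun b hb => hmY _ (hY b hb)
  have hsum : ∀ (W : β → ℝ) ω, W (Y ω) = ∑ b ∈ s, (A b).indicator (fun _ => (1 : ℝ)) ω * W b := by
    intro W ω
    rw [Finset.sum_eq_single_of_mem (Y ω) (hYs ω)]
    · simp [hA]
    · intro b _ hb
      simp [hA, Set.indicator, hb.symm]
  have hindI : ∀ b ∈ s, Integrable ((A b).indicator (fun _ => (1 : ℝ))) μ := fun b hb =>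
    (integrable_const 1).indicator (hAm b hb)
  have hone : ∀ b ∈ s, ∫ ω, (A b).indicator (fun _ => (1 : ℝ)) ω ∂μ = μ.real (A b) :=
    fun b hb => integral_indicator_one (hAm b hb)
  have hprod : ∀ b ∈ s, Integrable (fun ω => (A b).indicator (fun _ => (1 : ℝ)) ω * Z b ω) μ ∧
      ∫ ω, (A b).indicator (fun _ => (1 : ℝ)) ω * Z b ω ∂μ = μ.real (A b) * ∫ ω, Z b ω ∂μ := by
    intro b hb
    by_cases h0 : μ.real (A b) = 0
    · have hz : (fun ω => (A b).indicator (fun _ => (1 : ℝ)) ω * Z b ω) =ᵐ[μ] fun _ => 0 := by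
        have : μ (A b) = 0 := by simpa [Measure.real, ENNReal.toReal_eq_zero_iff] using h0
        filter_upwards [measure_eq_zero_iff_ae_notMem.1 this] with ω hω
        simp [hω]
      refine ⟨(integrable_zero _ _ _).congr hz.symm, ?_⟩
      rw [integral_congr_ae hz, h0]; simp
    · have hZi := hint b hb h0
      refine ⟨?_, ?_⟩
      · have := hZi.indicator (hAm b hb)
        refine this.congr (Filter.Eventually.of_forall fun ω => ?_)
        by_cases hω : ω ∈ A b <;> simp [hω]
      · have hI : IndepFun ((A b).indicator (fun _ => (1 : ℝ))) (Z b) μ := by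
          refine indep_of_indep_of_le_left (indep_of_indep_of_le_right hind ?_) ?_
          · exact (hZ b hb).comap_le
          · exact ((@measurable_const _ _ _ mY (1 : ℝ)).indicator (hY b hb)).comap_le
        have := hI.integral_fun_mul_eq_mul_integral (hindI b hb).1 hZi.1
        rw [this, hone b hb]
  have hinner : ∀ ω, ∫ ω', Z (Y ω') ω ∂μ = ∑ b ∈ s, μ.real (A b) * Z b ω := fun ω => by
    simpa only [smul_eq_mul] using (integral_comp_finite hYs hAm fun b => Z b ω).2
  refine ⟨?_, ?_⟩
  · simp_rw [fun ω => hsum (fun b => Z b ω) ω]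
    exact integrable_finsetSum _ fun b hb => (hprod b hb).1
  · simp_rw [hinner, fun ω => hsum (fun b => Z b ω) ω]
    rw [integral_finsetSum _ fun b hb => (hprod b hb).1, integral_finsetSum]
    · refine Finset.sum_congr rfl fun b hb => ?_
      rw [(hprod b hb).2, integral_const_mul]
    · intro b hb
      by_cases h0 : μ.real (A b) = 0
      · simp [h0]
      · exact (hint b hb h0).const_mul _

theorem integrable_inner_of_memLp_two {Ω E : Type*} [MeasurableSpace Ω] {μ : Measure Ω}
    [NormedAddCommGroup E] [InnerProductSpace ℝ E] {f g : Ω → E}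
    (hf : MemLp f 2 μ) (hg : MemLp g 2 μ) : Integrable (fun ω => inner ℝ (f ω) (g ω)) μ :=
  (hf.norm.integrable_mul hg.norm).mono (hf.1.inner hg.1)
    (Filter.Eventually.of_forall fun ω => by
      simpa using abs_real_inner_le_norm (f ω) (g ω))

/-! ### Smooth functions -/

/-- The quadratic upper bound of a function with Lipschitz gradient. -/
theorem le_add_inner_gradient_of_lipschitz {E : Type*} [NormedAddCommGroup E]
    [InnerProductSpace ℝ E] [CompleteSpace E] {f : E → ℝ} {L : ℝ} (hf : Differentiable ℝ f)
    (hL : ∀ w u, ‖∇ f w - ∇ f u‖ ≤ L * ‖w - u‖) (x v : E) :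
    f (x + v) ≤ f x + inner ℝ (∇ f x) v + L / 2 * ‖v‖ ^ 2 := by
  let φ : ℝ → ℝ := fun s => f (x + s • v) - s * inner ℝ (∇ f x) v - L / 2 * s ^ 2 * ‖v‖ ^ 2
  have hφ : ∀ s, HasDerivAt φ
      (inner ℝ (∇ f (x + s • v)) v - inner ℝ (∇ f x) v - L * s * ‖v‖ ^ 2) s := by
    intro s
    have h1 : HasDerivAt (fun s : ℝ => x + s • v) v s := by
      simpa using ((hasDerivAt_id s).smul_const v).const_add x
    have h2 : HasDerivAt (fun s : ℝ => f (x + s • v)) (inner ℝ (∇ f (x + s • v)) v) s := by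
      have := (hf (x + s • v)).hasGradientAt.hasFDerivAt.comp_hasDerivAt s h1
      rwa [InnerProductSpace.toDual_apply_apply] at this
    have h3 : HasDerivAt (fun s : ℝ => s * inner ℝ (∇ f x) v) (inner ℝ (∇ f x) v) s := by
      simpa using (hasDerivAt_id s).mul_const (inner ℝ (∇ f x) v)
    have h4 : HasDerivAt (fun s : ℝ => L / 2 * s ^ 2 * ‖v‖ ^ 2) (L * s * ‖v‖ ^ 2) s := by
      have := (((hasDerivAt_pow 2 s).const_mul (L / 2)).mul_const (‖v‖ ^ 2))
      refine this.congr_deriv ?_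
      rw [show 2 - 1 = 1 from rfl, pow_one, Nat.cast_ofNat]
      ring
    exact (h2.sub h3).sub h4
  have hanti : AntitoneOn φ (Set.Ici 0) := by
    refine antitoneOn_of_deriv_nonpos (convex_Ici 0)
      (fun s _ => (hφ s).continuousAt.continuousWithinAt)
      (fun s _ => (hφ s).differentiableAt.differentiableWithinAt) ?_
    intro s hs
    rw [interior_Ici] at hs
    have hs' : 0 < s := hs
    rw [(hφ s).deriv, ← inner_sub_left]
    have h1 := real_inner_le_norm (∇ f (x + s • v) - ∇ f x) v
    have h2 := hL (x + s • v) x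
    rw [add_sub_cancel_left, norm_smul, Real.norm_of_nonneg hs'.le] at h2
    nlinarith [norm_nonneg v]
  have h := hanti (Set.mem_Ici.2 le_rfl) (Set.mem_Ici.2 zero_le_one) zero_le_one
  simp only [φ, one_smul, zero_smul, add_zero, one_mul, zero_mul, one_pow, mul_one, ne_eq,
    OfNat.ofNat_ne_zero, not_false_eq_true, zero_pow, mul_zero, sub_zero] at h
  linarith

/-- No hypothesis on `f` is needed: the gradient is `0` wherever `f` is not differentiable, and the
set of points of differentiability is measurable. -/
theorem measurable_gradient (f : Param d → ℝ) : Measurable (gradient f) := by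
  unfold gradient
  exact ((InnerProductSpace.toDual ℝ (Param d)).symm.continuous.measurable).comp
    (measurable_fderiv ℝ f)

/-! ### Norm inequalities -/

section Norm

variable {E : Type*} [NormedAddCommGroup E]

theorem norm_sum_sq_le {ι : Type*} (s : Finset ι) (v : ι → E) :
    ‖∑ i ∈ s, v i‖ ^ 2 ≤ s.card * ∑ i ∈ s, ‖v i‖ ^ 2 :=
  (pow_le_pow_left₀ (norm_nonneg _) (norm_sum_le _ _) 2).trans sq_sum_le_card_mul_sum_sq

theorem norm_inv_smul_sum_sq_le [NormedSpace ℝ E] {K : ℕ} (hK : 0 < K) (v : Fin K → E) :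
    ‖(K : ℝ)⁻¹ • ∑ k, v k‖ ^ 2 ≤ (K : ℝ)⁻¹ * ∑ k, ‖v k‖ ^ 2 := by
  have hK' : (0 : ℝ) < K := by exact_mod_cast hK
  have h := norm_sum_sq_le Finset.univ v
  rw [Finset.card_univ, Fintype.card_fin] at h
  rw [norm_smul, mul_pow, Real.norm_of_nonneg (by positivity)]
  calc (K : ℝ)⁻¹ ^ 2 * ‖∑ k, v k‖ ^ 2
      ≤ (K : ℝ)⁻¹ ^ 2 * (K * ∑ k, ‖v k‖ ^ 2) := by gcongr
    _ = _ := by field_simp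

theorem norm_add_sq_le_two (a b : E) : ‖a + b‖ ^ 2 ≤ 2 * ‖a‖ ^ 2 + 2 * ‖b‖ ^ 2 := by
  have := norm_add_le a b
  nlinarith [sq_nonneg (‖a‖ - ‖b‖), norm_nonneg (a + b)]

theorem norm_add_sq_le_three (a b c : E) :
    ‖a + b + c‖ ^ 2 ≤ 3 * (‖a‖ ^ 2 + ‖b‖ ^ 2 + ‖c‖ ^ 2) := by
  have h : ‖a + b + c‖ ≤ ‖a‖ + ‖b‖ + ‖c‖ := norm_add₃_le
  nlinarith [sq_nonneg (‖a‖ - ‖b‖), sq_nonneg (‖a‖ - ‖c‖), sq_nonneg (‖b‖ - ‖c‖),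
    norm_nonneg (a + b + c)]

theorem norm_add_sq_le_young (a b : E) {c : ℝ} (hc : 0 < c) :
    ‖a + b‖ ^ 2 ≤ (1 + c) * ‖a‖ ^ 2 + (1 + c⁻¹) * ‖b‖ ^ 2 := by
  have h := norm_add_le a b
  have h2 : ‖a + b‖ ^ 2 ≤ (‖a‖ + ‖b‖) ^ 2 := by gcongr
  have h3 : 2 * ‖a‖ * ‖b‖ ≤ c * ‖a‖ ^ 2 + c⁻¹ * ‖b‖ ^ 2 := by
    have : 0 ≤ c⁻¹ * (c * ‖a‖ - ‖b‖) ^ 2 := by positivity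
    have e : c⁻¹ * (c * ‖a‖ - ‖b‖) ^ 2 = c * ‖a‖ ^ 2 + c⁻¹ * ‖b‖ ^ 2 - 2 * ‖a‖ * ‖b‖ := by
      field_simp; ring
    linarith
  linarith

/-- One step of the memory recursion; for masking probability `1 - l` it contracts the squared
memory by the factor `1 - l / 2`. -/
theorem mul_norm_add_sq_le_contraction (a b : E) {l : ℝ} (hl : 0 < l) (hl1 : l ≤ 1) :
    (1 - l) * ‖a + b‖ ^ 2 ≤
      (1 - l / 2) * ‖a‖ ^ 2 + (1 - l) * (2 - l) / l * ‖b‖ ^ 2 := by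
  rcases hl1.eq_or_lt with rfl | hl1
  · norm_num
  have h1 : 0 < 1 - l := by linarith
  have h := norm_add_sq_le_young a b (c := l / (2 * (1 - l))) (by positivity)
  calc (1 - l) * ‖a + b‖ ^ 2 ≤ (1 - l) * ((1 + l / (2 * (1 - l))) * ‖a‖ ^ 2 +
        (1 + (l / (2 * (1 - l)))⁻¹) * ‖b‖ ^ 2) := by gcongr
    _ = _ := by field_simp; ring

/-- The bound on the first-order term of the descent inequality: `F` is the gradient at the global
model, `F + a` the gradient at the virtual model, `e` the effect of the local drift. -/
theorem neg_inner_add_add_le [InnerProductSpace ℝ E] (F a e : E) :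
    -inner ℝ (F + a) (F + e) ≤ -(1 / 4) * ‖F‖ ^ 2 + 3 / 2 * ‖a‖ ^ 2 + ‖e‖ ^ 2 := by
  have e₁ : inner ℝ (F + a) (F + e) =
      ‖F‖ ^ 2 + inner ℝ a F + inner ℝ (F + a) e := by
    rw [inner_add_right, inner_add_left, real_inner_self_eq_norm_sq]
  have h₁ := abs_le.1 (abs_real_inner_le_norm a F)
  have h₂ := abs_le.1 (abs_real_inner_le_norm (F + a) e)
  have h₃ : ‖F + a‖ ^ 2 = ‖F‖ ^ 2 + 2 * inner ℝ a F + ‖a‖ ^ 2 := by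
    rw [norm_add_sq_real, real_inner_comm]
  rw [e₁]
  nlinarith [sq_nonneg (‖a‖ - ‖F‖), sq_nonneg (‖F + a‖ - 2 * ‖e‖), sq_nonneg ‖a‖]

end Norm

/-! ### Scalar recursions -/

theorem contractionConst_nonneg {l : ℝ} (hl : 0 < l) (hl1 : l ≤ 1) : 0 ≤ contractionConst l := by
  unfold contractionConst
  have : 0 ≤ 1 - l ^ 2 := by nlinarith
  positivity

/-- `contractionConst l * v` is invariant under the memory recursion with input `v`. -/
theorem contractionConst_step {l v u : ℝ} (hl : 0 < l) (hl1 : l ≤ 1) (hv : 0 ≤ v)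
    (hu : u ≤ contractionConst l * v) :
    (1 - l / 2) * u + (1 - l) * (2 - l) / l * v ≤ contractionConst l * v := by
  have h1 : (1 - l / 2) * u ≤ (1 - l / 2) * (contractionConst l * v) :=
    mul_le_mul_of_nonneg_left hu (by linarith)
  have h2 : (1 - l) * (2 - l) / l ≤ l / 2 * contractionConst l := by
    unfold contractionConst
    rw [div_le_iff₀ hl]
    have : l / 2 * (4 * (1 - l ^ 2) / l ^ 2) * l = 2 * (1 - l ^ 2) := by field_simp; ring
    rw [this]
    nlinarith
  nlinarith [mul_le_mul_of_nonneg_right h2 hv]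

/-- A recursion with factor at most `1 + (25 / 24) / Q` grows over `Q` steps to at most `5 Q`
times its input. -/
theorem le_of_drift_recursion {Q : ℕ} (hQ : 0 < Q) {A : ℕ → ℝ} {b c : ℝ}
    (hb : 0 ≤ b) (hc : c ≤ 1 + 25 / 24 / Q) (hA0 : A 0 = 0) (hA : ∀ q, 0 ≤ A q)
    (hrec : ∀ q < Q, A (q + 1) ≤ c * A q + b) : ∀ q ≤ Q, A q ≤ 5 * Q * b := by
  have hQ' : (0 : ℝ) < Q := by exact_mod_cast hQ
  set r : ℝ := 1 + 25 / 24 / Q with hr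
  have hr1 : 1 ≤ r := by
    have : (0 : ℝ) ≤ 25 / 24 / Q := by positivity
    linarith
  have key : ∀ q ≤ Q, A q ≤ q * r ^ q * b := by
    intro q
    induction q with
    | zero => intro _; simp [hA0]
    | succ q ih =>
      intro hq
      have h1 := ih (by omega)
      have h2 : c * A q ≤ r * (q * r ^ q * b) :=
        (mul_le_mul_of_nonneg_right hc (hA q)).trans (mul_le_mul_of_nonneg_left h1 (by linarith))
      have h3 : b ≤ r ^ (q + 1) * b := le_mul_of_one_le_left hb (one_le_pow₀ hr1)
      have := hrec q (by omega)
      calc A (q + 1) ≤ r * (q * r ^ q * b) + r ^ (q + 1) * b := by linarith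
        _ = _ := by push_cast; ring
  -- `r ^ Q ≤ exp (25 / 24) < 5`
  have hrQ : r ^ Q ≤ 5 := by
    have h1 : r ≤ Real.exp (25 / 24 / Q) := by
      rw [hr, add_comm]; exact Real.add_one_le_exp _
    have h2 : r ^ Q ≤ Real.exp (25 / 24) := by
      calc r ^ Q ≤ Real.exp (25 / 24 / Q) ^ Q := by gcongr
        _ = Real.exp (25 / 24) := by
          rw [← Real.exp_nat_mul]; congr 1; field_simp
    have h3 : Real.exp (25 / 24) = Real.exp 1 * Real.exp (1 / 24) := by
      rw [← Real.exp_add]; norm_num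
    have h4 : Real.exp (1 / 24) ≤ 24 / 23 := by
      have := Real.one_sub_le_exp_neg (1 / 24)
      rw [Real.exp_neg] at this
      have hp := Real.exp_pos (1 / 24)
      rw [← one_div, le_div_iff₀ hp] at this
      linarith
    have h5 := Real.exp_one_lt_d9
    nlinarith [Real.exp_pos (1 / 24)]
  intro q hq
  have hq' : (q : ℝ) ≤ Q := by exact_mod_cast hq
  calc A q ≤ q * r ^ q * b := key q hq
    _ ≤ Q * r ^ Q * b := by gcongr
    _ ≤ Q * 5 * b := by gcongr
    _ = _ := by ring

/-! ### Independence of the sources of randomness -/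

theorem indep_of_iIndep_of_indep_sup {Ω ι : Type*} {mΩ : MeasurableSpace Ω} {μ : Measure Ω}
    [IsProbabilityMeasure μ] {m : ι → MeasurableSpace Ω} {m₂ m₃ : MeasurableSpace Ω}
    (hm : ∀ i, m i ≤ mΩ) (h₂ : m₂ ≤ mΩ) (h₃ : m₃ ≤ mΩ) (hi : iIndep m μ)
    (h₁₂ : Indep (⨆ i, m i) m₂ μ) (h : Indep ((⨆ i, m i) ⊔ m₂) m₃ μ) (i : ι) :
    Indep (m i) ((⨆ j ∈ ({i}ᶜ : Set ι), m j) ⊔ m₂ ⊔ m₃) μ := by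
  have hothers : (⨆ j ∈ ({i}ᶜ : Set ι), m j) ≤ mΩ := iSup₂_le fun j _ => hm j
  have hsplit : m i ⊔ (⨆ j ∈ ({i}ᶜ : Set ι), m j) ≤ ⨆ j, m j :=
    sup_le (le_iSup m i) (iSup₂_le fun j _ => le_iSup m j)
  have h0 : Indep (m i) (⨆ j ∈ ({i}ᶜ : Set ι), m j) μ := by
    simpa using indep_iSup_of_disjoint hm hi (S := {i}) (T := {i}ᶜ) disjoint_compl_right
  have h1 := indep_sup_right_of_indep_sup_left (hm i) hothers h₂ h0
    (indep_of_indep_of_le_left h₁₂ hsplit)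
  refine indep_sup_right_of_indep_sup_left (hm i) (sup_le hothers h₂) h₃ h1
    (indep_of_indep_of_le_left h ?_)
  rw [← sup_assoc]
  exact sup_le_sup_right hsplit _

theorem comap_pi_eq_iSup {Ω ι : Type*} {X : ι → Type*} [∀ i, MeasurableSpace (X i)]
    (Y : ∀ i, Ω → X i) :
    MeasurableSpace.comap (fun ω i => Y i ω) inferInstance =
      ⨆ i, MeasurableSpace.comap (Y i) inferInstance := by
  unfold MeasurableSpace.pi
  rw [MeasurableSpace.comap_iSup]
  simp_rw [MeasurableSpace.comap_comp]
  rfl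

namespace System

variable {d K : ℕ} {Ξ : Type*} {S : System d K Ξ}

namespace Run

variable {Ω : Type*} (R : S.Run Ω)

/-- The σ-algebra of one mini-batch, indexed by round, device and local step. -/
noncomputable abbrev batchSigma (i : ℕ × Fin K × ℕ) : MeasurableSpace Ω :=
  MeasurableSpace.comap (R.batch i.1 i.2.1 i.2.2) inferInstance

/-- The σ-algebra of the fading coefficients of all devices in one round and entry. -/
noncomputable abbrev fadingSigma (i : ℕ × Fin d) : MeasurableSpace Ω :=
  MeasurableSpace.comap (fun ω (k : Fin K) => R.h i.1 k i.2 ω) inferInstance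

/-- The σ-algebra of one noise entry, indexed by round and entry. -/
noncomputable abbrev noiseSigma (i : ℕ × Fin d) : MeasurableSpace Ω :=
  MeasurableSpace.comap (R.n i.1 i.2) inferInstance

/-- All the randomness other than the mini-batch `i`. -/
noncomputable abbrev exceptBatch (i : ℕ × Fin K × ℕ) : MeasurableSpace Ω :=
  (⨆ j ∈ ({i}ᶜ : Set (ℕ × Fin K × ℕ)), R.batchSigma j) ⊔ (⨆ j, R.fadingSigma j) ⊔
    ⨆ j, R.noiseSigma j

/-- All the randomness other than the fading `i`. -/
noncomputable abbrev exceptFading (i : ℕ × Fin d) : MeasurableSpace Ω :=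
  (⨆ j ∈ ({i}ᶜ : Set (ℕ × Fin d)), R.fadingSigma j) ⊔ (⨆ j, R.batchSigma j) ⊔
    ⨆ j, R.noiseSigma j

/-- All the randomness other than the noise entry `i`. -/
noncomputable abbrev exceptNoise (i : ℕ × Fin d) : MeasurableSpace Ω :=
  (⨆ j ∈ ({i}ᶜ : Set (ℕ × Fin d)), R.noiseSigma j) ⊔
    ((⨆ j, R.batchSigma j) ⊔ ⨆ j, R.fadingSigma j)

variable {R}

theorem iSup_fadingSigma : (⨆ i, R.fadingSigma i) =
    MeasurableSpace.comap (fun ω (i : ℕ × Fin K × Fin d) => R.h i.1 i.2.1 i.2.2 ω)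
      inferInstance := by
  rw [comap_pi_eq_iSup (fun (i : ℕ × Fin K × Fin d) ω => R.h i.1 i.2.1 i.2.2 ω)]
  simp_rw [fadingSigma,
    fun i : ℕ × Fin d => comap_pi_eq_iSup (fun (k : Fin K) ω => R.h i.1 k i.2 ω)]
  apply le_antisymm
  · exact iSup_le fun i => iSup_le fun k => le_iSup
      (fun i : ℕ × Fin K × Fin d => MeasurableSpace.comap (R.h i.1 i.2.1 i.2.2) inferInstance)
      (i.1, k, i.2)
  · exact iSup_le fun i => le_iSup_of_le (i.1, i.2.2) (le_iSup
      (fun k => MeasurableSpace.comap (R.h i.1 k i.2.2) inferInstance) i.2.1)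

section Model

variable [mΩ : MeasurableSpace Ω] {μ : Measure Ω}

theorem batchSigma_le (hM : R.IsModel μ) (i) : R.batchSigma i ≤ mΩ :=
  (hM.batch_measurable _ _ _).comap_le

theorem fadingSigma_le (hM : R.IsModel μ) (i) : R.fadingSigma i ≤ mΩ :=
  (measurable_pi_lambda _ fun k => hM.h_measurable i.1 k i.2).comap_le

theorem noiseSigma_le (hM : R.IsModel μ) (i) : R.noiseSigma i ≤ mΩ :=
  (hM.n_measurable _ _).comap_le

theorem indep_batchSigma_fadingSigma (hM : R.IsModel μ) :
    Indep (⨆ i, R.batchSigma i) (⨆ i, R.fadingSigma i) μ := by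
  have h := hM.batch_indep_h
  rw [IndepFun_iff_Indep] at h
  rw [iSup_fadingSigma]
  rwa [comap_pi_eq_iSup (fun (i : ℕ × Fin K × ℕ) ω => R.batch i.1 i.2.1 i.2.2 ω)] at h

theorem indep_sup_noiseSigma (hM : R.IsModel μ) :
    Indep ((⨆ i, R.batchSigma i) ⊔ ⨆ i, R.fadingSigma i) (⨆ i, R.noiseSigma i) μ := by
  have h := hM.batch_h_indep_n
  rw [IndepFun_iff_Indep] at h
  rw [comap_pi_eq_iSup (fun (i : ℕ × Fin d) ω => R.n i.1 i.2 ω)] at h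
  refine indep_of_indep_of_le_left h ?_
  rw [iSup_fadingSigma]
  unfold batchSigma
  rw [← comap_pi_eq_iSup (fun (i : ℕ × Fin K × ℕ) ω => R.batch i.1 i.2.1 i.2.2 ω)]
  have hpair := comap_measurable (m := Prod.instMeasurableSpace)
    (fun ω => ((fun (i : ℕ × Fin K × ℕ) => R.batch i.1 i.2.1 i.2.2 ω),
      (fun (i : ℕ × Fin K × Fin d) => R.h i.1 i.2.1 i.2.2 ω)))
  exact sup_le (measurable_fst.comp hpair).comap_le (measurable_snd.comp hpair).comap_le

variable [IsProbabilityMeasure μ]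

theorem indep_exceptBatch (hM : R.IsModel μ) (i) : Indep (R.batchSigma i) (R.exceptBatch i) μ :=
  indep_of_iIndep_of_indep_sup (batchSigma_le hM) (iSup_le (fadingSigma_le hM))
    (iSup_le (noiseSigma_le hM)) hM.batch_indep (indep_batchSigma_fadingSigma hM)
    (indep_sup_noiseSigma hM) i

theorem indep_exceptFading (hM : R.IsModel μ) (i) :
    Indep (R.fadingSigma i) (R.exceptFading i) μ :=
  indep_of_iIndep_of_indep_sup (fadingSigma_le hM) (iSup_le (batchSigma_le hM))
    (iSup_le (noiseSigma_le hM)) hM.h_indep (indep_batchSigma_fadingSigma hM).symm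
    (by rw [sup_comm]; exact indep_sup_noiseSigma hM) i

theorem indep_exceptNoise (hM : R.IsModel μ) (i) :
    Indep (R.noiseSigma i) (R.exceptNoise i) μ := by
  have h := indep_of_iIndep_of_indep_sup (m₃ := ⊥) (noiseSigma_le hM)
    (sup_le (iSup_le (batchSigma_le hM)) (iSup_le (fadingSigma_le hM))) bot_le hM.n_indep
    (indep_sup_noiseSigma hM).symm (indep_bot_right _) i
  rwa [sup_bot_eq] at h

end Model

end Run

/-! ### Measurability of the iterates -/

theorem measurable_stochGrad (S : System d K Ξ) (b : Finset Ξ) : Measurable (S.stochGrad b) := by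
  have hsum : Measurable fun θ => ∑ ξ ∈ b, gradient (fun w => S.loss w ξ) θ :=
    Finset.measurable_fun_sum _ fun ξ _ => measurable_gradient _
  exact hsum.const_smul (b.card : ℝ)⁻¹

section Measurable

variable {Ω : Type*} [MeasurableSpace Ω]

theorem measurableSet_eq_of_subset {Y : Ω → Finset Ξ} (hY : Measurable Y) {D : Finset Ξ}
    (hD : ∀ ω, Y ω ⊆ D) (b : Finset Ξ) : MeasurableSet {ω | Y ω = b} := by
  by_cases hb : b ⊆ D
  · have : {ω | Y ω = b} = ⋂ ξ ∈ D, {ω | ξ ∈ Y ω ↔ ξ ∈ b} := by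
      ext ω
      simp only [Set.mem_ofPred_eq, Set.mem_iInter]
      refine ⟨fun h ξ _ => by rw [h], fun h => Finset.ext fun ξ => ?_⟩
      by_cases hξ : ξ ∈ D
      · exact h ξ hξ
      · exact iff_of_false (fun h' => hξ (hD ω h')) (fun h' => hξ (hb h'))
    rw [this]
    refine Finset.measurableSet_biInter _ fun ξ _ => ?_
    have h := measurable_finset_iff.1 hY ξ
    exact measurableSet_setOfPred.2 (h.iff measurable_const)
  · have : {ω | Y ω = b} = ∅ := by
      ext ω
      simp only [Set.mem_ofPred_eq, Set.mem_empty_iff_false, iff_false]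
      rintro rfl
      exact hb (hD ω)
    rw [this]
    exact MeasurableSet.empty

/-- Although `Finset Ξ` need not be countable, a mini-batch takes finitely many values, so that
the stochastic gradient at a random point is a finite sum over these values. -/
theorem measurable_stochGrad_comp (S : System d K Ξ) {Y : Ω → Finset Ξ} (hY : Measurable Y)
    {D : Finset Ξ} (hD : ∀ ω, Y ω ⊆ D) {θ : Ω → Param d} (hθ : Measurable θ) :
    Measurable fun ω => S.stochGrad (Y ω) (θ ω) := by
  classical
  have : (fun ω => S.stochGrad (Y ω) (θ ω)) = fun ω =>
      ∑ b ∈ D.powerset, {ω | Y ω = b}.indicator (fun ω => S.stochGrad b (θ ω)) ω := by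
    funext ω
    rw [Finset.sum_eq_single_of_mem (Y ω) (Finset.mem_powerset.2 (hD ω))]
    · simp
    · intro b _ hb
      simp [Set.indicator, hb.symm]
  rw [this]
  exact Finset.measurable_fun_sum _ fun b _ =>
    ((S.measurable_stochGrad b).comp hθ).indicator (measurableSet_eq_of_subset hY hD b)

theorem measurable_localIter (S : System d K Ξ) (η : ℝ) {b : ℕ → Ω → Finset Ξ} {D : Finset Ξ}
    (hD : ∀ q ω, b q ω ⊆ D) {θ : Ω → Param d} (hθ : Measurable θ) :
    ∀ p, (∀ q < p, Measurable (b q)) →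
      Measurable fun ω => S.localIter η (fun q => b q ω) (θ ω) p
  | 0, _ => hθ
  | p + 1, hb => by
    have h := measurable_localIter S η hD hθ p fun q hq => hb q (by omega)
    exact h.sub ((S.measurable_stochGrad_comp (hb p (by omega)) (hD p) h).const_smul η)

theorem measurable_modelDiff (S : System d K Ξ) (η : ℝ) {b : ℕ → Ω → Finset Ξ} {D : Finset Ξ}
    (hD : ∀ q ω, b q ω ⊆ D) {θ : Ω → Param d} (hθ : Measurable θ)
    (hb : ∀ q, Measurable (b q)) :
    Measurable fun ω => S.modelDiff η (fun q => b q ω) (θ ω) :=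
  (S.measurable_localIter η hD hθ 0 fun q _ => hb q).sub
    (S.measurable_localIter η hD hθ S.Q fun q _ => hb q)

theorem measurable_mask (S : System d K Ξ) (k : Fin K) : Measurable (S.mask k) := by
  unfold mask
  exact Measurable.ite (measurableSet_le measurable_const (measurable_norm.pow_const 2))
    measurable_const measurable_const

theorem measurable_powerFactor (S : System d K Ξ) (r : ℝ) (k : Fin K) :
    Measurable (S.powerFactor r k) := by
  unfold powerFactor
  fun_prop

/-- The σ-algebra on `Ω` is arbitrary here, so that this also yields measurability with respect
to the randomness of the past. -/
theorem Run.measurable_state (R : S.Run Ω) (η : ℝ)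
    (hsub : ∀ t k q ω, R.batch t k q ω ⊆ S.data k) : ∀ t,
    (∀ s < t, ∀ k q, Measurable (R.batch s k q)) → (∀ s < t, ∀ k j, Measurable (R.h s k j)) →
    (∀ s < t, ∀ j, Measurable (R.n s j)) → Measurable (R.state η t)
  | 0, _, _, _ => measurable_const
  | t + 1, hb, hh, hn => by
    have h := measurable_state R η hsub t (fun s hs => hb s (by omega))
      (fun s hs => hh s (by omega)) (fun s hs => hn s (by omega))
    have hθ : Measurable fun ω => (R.state η t ω).1 := h.fst
    have hm : ∀ k, Measurable fun ω => (R.state η t ω).2 k := fun k =>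
      (measurable_pi_apply k).comp h.snd
    have hmask : ∀ k j, Measurable fun ω => S.mask k (R.h t k j ω) := fun k j =>
      (S.measurable_mask k).comp (hh t (by omega) k j)
    have hpow : ∀ k j, Measurable fun ω => S.powerFactor (R.ρ t) k (R.h t k j ω) := fun k j =>
      (S.measurable_powerFactor _ k).comp (hh t (by omega) k j)
    have hh' := hh t (by omega)
    have hn' := hn t (by omega)
    have hcomp : ∀ k, Measurable fun ω => S.compensated η (fun q => R.batch t k q ω)
        (R.state η t ω).1 ((R.state η t ω).2 k) := fun k =>
      (hm k).add (S.measurable_modelDiff η (hsub t k) hθ (hb t (by omega) k))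
    have hcomp' : ∀ k j, Measurable fun ω => S.compensated η (fun q => R.batch t k q ω)
        (R.state η t ω).1 ((R.state η t ω).2 k) j := fun k j => by
      have := hcomp k
      fun_prop
    have hsig : ∀ k j, Measurable fun ω => S.signal η (fun q => R.batch t k q ω)
        (R.state η t ω).1 ((R.state η t ω).2 k) j := fun k j => by
      have := (hcomp k).const_smul η⁻¹
      unfold signal
      fun_prop
    refine Measurable.prodMk ?_ (measurable_pi_lambda _ fun k => ?_)
    · refine hθ.sub (Measurable.fun_const_smul ?_ _)
      unfold received
      refine (WithLp.measurable_toLp _ _).comp (measurable_pi_lambda _ fun j => ?_)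
      refine (Complex.measurable_re.comp (Finset.measurable_fun_sum _ fun k _ => ?_)).add (hn' j)
      exact ((((measurable_const.mul (hh' k j)).mul (hpow k j)).mul
        (Complex.measurable_ofReal.comp (hmask k j))).mul
        (Complex.measurable_ofReal.comp (hsig k j)))
    · refine (hcomp k).sub ?_
      exact (WithLp.measurable_toLp _ _).comp
        (measurable_pi_lambda _ fun j => (hmask k j).mul (hcomp' k j))

end Measurable

end System

/-! ### The virtual iterates -/

namespace System

variable {d K : ℕ} {Ξ : Type*} {S : System d K Ξ}

theorem mask_sq (S : System d K Ξ) (k : Fin K) (z : ℂ) : S.mask k z ^ 2 = S.mask k z := by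
  unfold mask
  split_ifs <;> norm_num

theorem mask_nonneg (S : System d K Ξ) (k : Fin K) (z : ℂ) : 0 ≤ S.mask k z := by
  unfold mask
  split_ifs <;> norm_num

theorem mask_le_one (S : System d K Ξ) (k : Fin K) (z : ℂ) : S.mask k z ≤ 1 := by
  unfold mask
  split_ifs <;> norm_num

/-- Where the mask is `1` the fading coefficient does not vanish, so channel inversion is exact. -/
theorem channel_inversion (S : System d K Ξ) (r : ℝ) (k : Fin K) (z : ℂ) :
    (√(S.κ k) : ℂ) * z * S.powerFactor r k z * (S.mask k z : ℂ) = ((√r * S.mask k z : ℝ) : ℂ) := by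
  unfold mask powerFactor
  split_ifs with h
  · have hz : z ≠ 0 := by
      rintro rfl
      have := S.ε_pos k
      norm_num at h
      linarith
    have hκ : (√(S.κ k) : ℂ) ≠ 0 := by
      exact_mod_cast (Real.sqrt_pos.2 (S.κ_pos k)).ne'
    push_cast
    field_simp
  · simp

theorem received_apply (S : System d K Ξ) (r : ℝ) (h : Fin K → Fin d → ℂ) (n : Fin d → ℝ)
    (x : Fin K → Param d) (j : Fin d) :
    S.received r h n x j = √r * ∑ k, S.mask k (h k j) * x k j + n j := by
  have e : S.received r h n x j = (∑ k, (√(S.κ k) : ℂ) * h k j * S.powerFactor r k (h k j) *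
      (S.mask k (h k j) : ℂ) * (x k j : ℂ)).re + n j := rfl
  rw [e]
  simp_rw [S.channel_inversion, ← Complex.ofReal_mul, ← Complex.ofReal_sum, Complex.ofReal_re]
  rw [Finset.mul_sum]
  simp_rw [mul_assoc]

theorem norm_powerFactor_sq (S : System d K Ξ) {r : ℝ} (hr : 0 ≤ r) (k : Fin K) (z : ℂ) :
    ‖S.powerFactor r k z‖ ^ 2 = r * (S.κ k * ‖z‖ ^ 2)⁻¹ := by
  unfold powerFactor
  rw [norm_div, norm_mul, Complex.norm_real, Complex.norm_real, div_pow, mul_pow,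
    Real.norm_of_nonneg (Real.sqrt_nonneg _), Real.norm_of_nonneg (Real.sqrt_nonneg _),
    Real.sq_sqrt hr, Real.sq_sqrt (S.κ_pos k).le, div_eq_mul_inv]

theorem inv_mul_mask_le (S : System d K Ξ) (k : Fin K) (z : ℂ) :
    (S.κ k * ‖z‖ ^ 2)⁻¹ * S.mask k z ≤ (S.κ k * S.ε k)⁻¹ * S.mask k z := by
  have hκ := S.κ_pos k
  have hε := S.ε_pos k
  unfold mask
  split_ifs with h
  · gcongr
  · simp

namespace Run

variable {Ω : Type*}

/-- The local iterate `θ_k^{(t,q)}`. -/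
noncomputable def localTheta (R : S.Run Ω) (η : ℝ) (t : ℕ) (k : Fin K) (q : ℕ) (ω : Ω) : Param d :=
  S.localIter η (fun q => R.batch t k q ω) (R.theta η t ω) q

/-- The stochastic gradient at `θ_k^{(t,q)}`. -/
noncomputable def localGrad (R : S.Run Ω) (η : ℝ) (t : ℕ) (k : Fin K) (q : ℕ) (ω : Ω) : Param d :=
  S.stochGrad (R.batch t k q ω) (R.localTheta η t k q ω)

/-- The model difference `Δ_k^{(t)}`. -/
noncomputable def delta (R : S.Run Ω) (η : ℝ) (t : ℕ) (k : Fin K) (ω : Ω) : Param d :=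
  S.modelDiff η (fun q => R.batch t k q ω) (R.theta η t ω)

/-- The average `K⁻¹ ∑_k Δ_k^{(t)}` of the model differences. -/
noncomputable def avgDelta (R : S.Run Ω) (η : ℝ) (t : ℕ) (ω : Ω) : Param d :=
  (K : ℝ)⁻¹ • ∑ k, R.delta η t k ω

/-- The noise vector of round `t`. -/
noncomputable def noise (R : S.Run Ω) (t : ℕ) (ω : Ω) : Param d :=
  WithLp.toLp 2 fun j => R.n t j ω

/-- The virtual model `θ^{(t)} - K⁻¹ ∑_k m_k^{(t)}`, from which everything still stored in the
memories has already been subtracted. -/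
noncomputable def virtual (R : S.Run Ω) (η : ℝ) (t : ℕ) (ω : Ω) : Param d :=
  R.theta η t ω - (K : ℝ)⁻¹ • ∑ k, R.memory η t k ω

variable (R : S.Run Ω)

theorem localTheta_zero (η : ℝ) (t : ℕ) (k : Fin K) (ω : Ω) :
    R.localTheta η t k 0 ω = R.theta η t ω := rfl

theorem localTheta_succ (η : ℝ) (t : ℕ) (k : Fin K) (q : ℕ) (ω : Ω) :
    R.localTheta η t k (q + 1) ω = R.localTheta η t k q ω - η • R.localGrad η t k q ω := rfl

theorem localTheta_eq (η : ℝ) (t : ℕ) (k : Fin K) (ω : Ω) (p : ℕ) :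
    R.localTheta η t k p ω = R.theta η t ω - η • ∑ q ∈ Finset.range p, R.localGrad η t k q ω := by
  induction p with
  | zero => simp [localTheta_zero]
  | succ p ih => rw [localTheta_succ, ih, Finset.sum_range_succ, smul_add, sub_sub]

theorem delta_eq (η : ℝ) (t : ℕ) (k : Fin K) (ω : Ω) :
    R.delta η t k ω = η • ∑ q ∈ Finset.range S.Q, R.localGrad η t k q ω := by
  have : R.delta η t k ω = R.localTheta η t k 0 ω - R.localTheta η t k S.Q ω := rfl
  rw [this, localTheta_zero, localTheta_eq, sub_sub_cancel]

theorem avgDelta_eq (η : ℝ) (t : ℕ) (ω : Ω) : R.avgDelta η t ω =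
    η • ∑ q ∈ Finset.range S.Q, (K : ℝ)⁻¹ • ∑ k, R.localGrad η t k q ω := by
  simp_rw [avgDelta, delta_eq, ← Finset.smul_sum]
  rw [Finset.sum_comm, smul_comm]

theorem x_eq (η : ℝ) (t : ℕ) (k : Fin K) (ω : Ω) :
    R.x η t k ω = η⁻¹ • (R.memory η t k ω + R.delta η t k ω) := rfl

theorem memory_zero (η : ℝ) (k : Fin K) (ω : Ω) : R.memory η 0 k ω = 0 := rfl

theorem theta_zero (η : ℝ) (ω : Ω) : R.theta η 0 ω = S.θ₀ := rfl

theorem virtual_zero (η : ℝ) (ω : Ω) : R.virtual η 0 ω = S.θ₀ := by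
  simp [virtual, memory_zero, theta_zero]

theorem memory_succ_apply (η : ℝ) (t : ℕ) (k : Fin K) (ω : Ω) (j : Fin d) :
    R.memory η (t + 1) k ω j =
      (1 - S.mask k (R.h t k j ω)) * (R.memory η t k ω + R.delta η t k ω) j := by
  have : R.memory η (t + 1) k ω = (R.memory η t k ω + R.delta η t k ω) -
      WithLp.toLp 2 fun j => S.mask k (R.h t k j ω) * (R.memory η t k ω + R.delta η t k ω) j := rfl
  rw [this, PiLp.sub_apply]
  ring

theorem norm_memory_succ_sq (η : ℝ) (t : ℕ) (k : Fin K) (ω : Ω) :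
    ‖R.memory η (t + 1) k ω‖ ^ 2 = ∑ j, (1 - S.mask k (R.h t k j ω)) *
      (R.memory η t k ω + R.delta η t k ω) j ^ 2 := by
  rw [EuclideanSpace.real_norm_sq_eq]
  refine Finset.sum_congr rfl fun j _ => ?_
  rw [memory_succ_apply, mul_pow]
  congr 1
  linear_combination S.mask_sq k (R.h t k j ω)

theorem norm_memory_succ_le (η : ℝ) (t : ℕ) (k : Fin K) (ω : Ω) :
    ‖R.memory η (t + 1) k ω‖ ≤ ‖R.memory η t k ω + R.delta η t k ω‖ := by
  refine le_of_sq_le_sq ?_ (norm_nonneg _)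
  rw [norm_memory_succ_sq, EuclideanSpace.real_norm_sq_eq]
  refine Finset.sum_le_sum fun j _ => ?_
  have := S.mask_nonneg k (R.h t k j ω)
  exact mul_le_of_le_one_left (sq_nonneg _) (by linarith)

/-- The error feedback makes the masks cancel in the virtual iteration. -/
theorem virtual_succ {η : ℝ} (hη : 0 < η) {t : ℕ} (hρ : 0 < R.ρ t) (ω : Ω) :
    R.virtual η (t + 1) ω = R.virtual η t ω +
      -(R.avgDelta η t ω + (η / (√(R.ρ t) * K)) • R.noise t ω) := by
  have hs : √(R.ρ t) ≠ 0 := (Real.sqrt_pos.2 hρ).ne'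
  have hθ : R.theta η (t + 1) ω = R.theta η t ω - (η / (√(R.ρ t) * K)) •
      S.received (R.ρ t) (fun k j => R.h t k j ω) (fun j => R.n t j ω)
        (fun k => R.x η t k ω) := rfl
  ext j
  simp only [virtual, hθ, PiLp.sub_apply, PiLp.add_apply, PiLp.neg_apply, PiLp.smul_apply,
    smul_eq_mul, received_apply, WithLp.ofLp_sum, Finset.sum_apply, memory_succ_apply, x_eq, noise,
    avgDelta]
  rcases Nat.eq_zero_or_pos K with hK | hK
  · subst hK; simp
  have hK' : (K : ℝ) ≠ 0 := by positivity
  have e1 : ∑ k, S.mask k (R.h t k j ω) * (η⁻¹ * (R.memory η t k ω j + R.delta η t k ω j)) =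
      η⁻¹ * ∑ k, S.mask k (R.h t k j ω) * (R.memory η t k ω j + R.delta η t k ω j) := by
    rw [Finset.mul_sum]; exact Finset.sum_congr rfl fun k _ => by ring
  have e2 : ∑ k, (1 - S.mask k (R.h t k j ω)) * (R.memory η t k ω j + R.delta η t k ω j) =
      ∑ k, R.memory η t k ω j + ∑ k, R.delta η t k ω j -
      ∑ k, S.mask k (R.h t k j ω) * (R.memory η t k ω j + R.delta η t k ω j) := by
    rw [← Finset.sum_add_distrib, ← Finset.sum_sub_distrib]
    exact Finset.sum_congr rfl fun k _ => by ring
  rw [e1, e2]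
  field_simp
  ring

end Run
end System

namespace System.Run

variable {d K : ℕ} {Ξ : Type*} {S : System d K Ξ} {Ω : Type*} {R : S.Run Ω}

/-! ### What the iterates depend on -/

section Measurable

variable [MeasurableSpace Ω]

theorem measurable_localTheta_of {η : ℝ} (hsub : ∀ t k q ω, R.batch t k q ω ⊆ S.data k) {t : ℕ}
    (h : Measurable (R.state η t)) {k : Fin K} {p : ℕ}
    (hb : ∀ q < p, Measurable (R.batch t k q)) : Measurable (R.localTheta η t k p) :=
  S.measurable_localIter η (hsub t k) h.fst p hb

theorem measurable_memory_of {η : ℝ} {t : ℕ} (h : Measurable (R.state η t)) (k : Fin K) :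
    Measurable (R.memory η t k) :=
  (measurable_pi_apply k).comp h.snd

theorem measurable_virtual_of {η : ℝ} {t : ℕ} (h : Measurable (R.state η t)) :
    Measurable (R.virtual η t) :=
  h.fst.sub ((Finset.measurable_fun_sum _ fun k _ => measurable_memory_of h k).fun_const_smul
    (K : ℝ)⁻¹)

theorem measurable_delta_of {η : ℝ} (hsub : ∀ t k q ω, R.batch t k q ω ⊆ S.data k) {t : ℕ}
    (h : Measurable (R.state η t)) {k : Fin K}
    (hb : ∀ q, Measurable (R.batch t k q)) : Measurable (R.delta η t k) :=
  S.measurable_modelDiff η (hsub t k) h.fst hb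

end Measurable

section Past

theorem measurable_batch_exceptNoise (i : ℕ × Fin d) (t : ℕ) (k : Fin K) (q : ℕ) :
    Measurable[R.exceptNoise i] (R.batch t k q) := by
  refine (comap_measurable (R.batch t k q)).mono ?_ le_rfl
  exact (le_iSup R.batchSigma (t, k, q)).trans (le_sup_left.trans le_sup_right)

theorem measurable_batch_exceptFading (i : ℕ × Fin d) (t : ℕ) (k : Fin K) (q : ℕ) :
    Measurable[R.exceptFading i] (R.batch t k q) := by
  refine (comap_measurable (R.batch t k q)).mono ?_ le_rfl
  exact (le_iSup R.batchSigma (t, k, q)).trans (le_sup_right.trans le_sup_left)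

variable [MeasurableSpace Ω] {μ : Measure Ω}

theorem measurable_state_exceptBatch (hM : R.IsModel μ) (η : ℝ) (t : ℕ) (k : Fin K) (q : ℕ) :
    Measurable[R.exceptBatch (t, k, q)] (R.state η t) := by
  refine @Run.measurable_state d K Ξ S Ω (R.exceptBatch (t, k, q)) R η hM.batch_subset t
    (fun s hs k' q' => ?_) (fun s hs k' j => ?_) (fun s hs j => ?_)
  · refine (comap_measurable (R.batch s k' q')).mono ?_ le_rfl
    have hne : (s, k', q') ∈ ({(t, k, q)}ᶜ : Set (ℕ × Fin K × ℕ)) := by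
      simp [hs.ne]
    exact (le_iSup₂_of_le (f := fun i (_ : i ∈ ({(t, k, q)}ᶜ : Set (ℕ × Fin K × ℕ))) =>
      R.batchSigma i) _ hne le_rfl).trans (le_sup_left.trans le_sup_left)
  · have h := comap_measurable (m := MeasurableSpace.pi) (fun ω (k : Fin K) => R.h s k j ω)
    have h' := (measurable_pi_apply k').comp h
    refine h'.mono ?_ le_rfl
    exact (le_iSup R.fadingSigma (s, j)).trans (le_sup_right.trans le_sup_left)
  · refine (comap_measurable (R.n s j)).mono ?_ le_rfl
    exact (le_iSup R.noiseSigma (s, j)).trans le_sup_right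

theorem measurable_localTheta_exceptBatch (hM : R.IsModel μ) (η : ℝ) (t : ℕ) (k : Fin K) (q : ℕ) :
    Measurable[R.exceptBatch (t, k, q)] (R.localTheta η t k q) := by
  refine @measurable_localTheta_of d K Ξ S Ω R (R.exceptBatch (t, k, q)) η hM.batch_subset t
    (measurable_state_exceptBatch hM η t k q) k q fun q' hq' => ?_
  refine (comap_measurable (R.batch t k q')).mono ?_ le_rfl
  have hne : (t, k, q') ∈ ({(t, k, q)}ᶜ : Set (ℕ × Fin K × ℕ)) := by
    simp [hq'.ne]
  exact (le_iSup₂_of_le (f := fun i (_ : i ∈ ({(t, k, q)}ᶜ : Set (ℕ × Fin K × ℕ))) =>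
    R.batchSigma i) _ hne le_rfl).trans (le_sup_left.trans le_sup_left)

theorem measurable_state_exceptFading (hM : R.IsModel μ) (η : ℝ) (t : ℕ) (j : Fin d) :
    Measurable[R.exceptFading (t, j)] (R.state η t) := by
  refine @Run.measurable_state d K Ξ S Ω (R.exceptFading (t, j)) R η hM.batch_subset t
    (fun s hs k' q' => measurable_batch_exceptFading _ _ _ _) (fun s hs k' j' => ?_)
    (fun s hs j' => ?_)
  · have h := comap_measurable (m := MeasurableSpace.pi) (fun ω (k : Fin K) => R.h s k j' ω)
    have h' := (measurable_pi_apply k').comp h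
    refine h'.mono ?_ le_rfl
    have hne : (s, j') ∈ ({(t, j)}ᶜ : Set (ℕ × Fin d)) := by
      simp [hs.ne]
    exact (le_iSup₂_of_le (f := fun i (_ : i ∈ ({(t, j)}ᶜ : Set (ℕ × Fin d))) =>
      R.fadingSigma i) _ hne le_rfl).trans (le_sup_left.trans le_sup_left)
  · refine (comap_measurable (R.n s j')).mono ?_ le_rfl
    exact (le_iSup R.noiseSigma (s, j')).trans le_sup_right

theorem measurable_compensated_exceptFading (hM : R.IsModel μ) (η : ℝ) (t : ℕ) (k : Fin K)
    (j : Fin d) :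
    Measurable[R.exceptFading (t, j)] fun ω => R.memory η t k ω + R.delta η t k ω := by
  have h := measurable_state_exceptFading hM η t j
  have h1 := @measurable_memory_of d K Ξ S Ω R (R.exceptFading (t, j)) η t h k
  have h2 := @measurable_delta_of d K Ξ S Ω R (R.exceptFading (t, j)) η hM.batch_subset t h k
    fun q => measurable_batch_exceptFading _ _ _ _
  exact h1.add h2

theorem measurable_state_exceptNoise (hM : R.IsModel μ) (η : ℝ) (t : ℕ) (j : Fin d) :
    Measurable[R.exceptNoise (t, j)] (R.state η t) := by
  refine @Run.measurable_state d K Ξ S Ω (R.exceptNoise (t, j)) R η hM.batch_subset t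
    (fun s hs k' q' => measurable_batch_exceptNoise _ _ _ _) (fun s hs k' j' => ?_)
    (fun s hs j' => ?_)
  · have h := comap_measurable (m := MeasurableSpace.pi) (fun ω (k : Fin K) => R.h s k j' ω)
    have h' := (measurable_pi_apply k').comp h
    refine h'.mono ?_ le_rfl
    exact (le_iSup R.fadingSigma (s, j')).trans (le_sup_right.trans le_sup_right)
  · refine (comap_measurable (R.n s j')).mono ?_ le_rfl
    have hne : (s, j') ∈ ({(t, j)}ᶜ : Set (ℕ × Fin d)) := by
      simp [hs.ne]
    exact (le_iSup₂_of_le (f := fun i (_ : i ∈ ({(t, j)}ᶜ : Set (ℕ × Fin d))) =>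
      R.noiseSigma i) _ hne le_rfl).trans le_sup_left

theorem measurable_state_model (hM : R.IsModel μ) (η : ℝ) (t : ℕ) : Measurable (R.state η t) :=
  R.measurable_state η hM.batch_subset t (fun _ _ _ _ => hM.batch_measurable _ _ _)
    (fun _ _ _ _ => hM.h_measurable _ _ _) (fun _ _ _ => hM.n_measurable _ _)

end Past

end System.Run

/-! ### The loss functions -/

namespace System

variable {d K : ℕ} {Ξ : Type*} {S : System d K Ξ} {Lk : Fin K → ℝ}

theorem LSmooth.differentiable_globalLoss (hs : S.LSmooth Lk) :
    Differentiable ℝ S.globalLoss := by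
  unfold globalLoss
  exact (Differentiable.fun_sum fun k _ => (hs k).1).const_mul _

theorem LSmooth.gradient_globalLoss (hs : S.LSmooth Lk) (θ : Param d) :
    ∇ S.globalLoss θ = (K : ℝ)⁻¹ • ∑ k, ∇ (S.localLoss k) θ := by
  refine HasGradientAt.gradient ?_
  rw [hasGradientAt_iff_hasFDerivAt, map_smul, map_sum]
  have h := (HasFDerivAt.fun_sum (u := Finset.univ) fun k _ =>
    ((hs k).1 θ).hasGradientAt.hasFDerivAt).const_mul (K : ℝ)⁻¹
  exact h

theorem LSmooth.nonneg (hs : S.LSmooth Lk) (hd : 0 < d) (k : Fin K) : 0 ≤ Lk k := by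
  have : Nonempty (Fin d) := ⟨⟨0, hd⟩⟩
  obtain ⟨v, hv⟩ := exists_ne (0 : Param d)
  have h := (norm_nonneg _).trans ((hs k).2 v 0)
  rw [sub_zero] at h
  exact nonneg_of_mul_nonneg_left h (norm_pos_iff.2 hv)

theorem LSmooth.mono_iSup (hs : S.LSmooth Lk) : S.LSmooth fun _ => ⨆ k, Lk k := fun k =>
  ⟨(hs k).1, fun w u => ((hs k).2 w u).trans (mul_le_mul_of_nonneg_right
    (le_ciSup (Finite.bddAbove_range Lk) k) (norm_nonneg _))⟩

theorem LSmooth.globalLoss_lipschitz {L : ℝ} (hs : S.LSmooth fun _ => L) (hK : 0 < K)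
    (w u : Param d) : ‖∇ S.globalLoss w - ∇ S.globalLoss u‖ ≤ L * ‖w - u‖ := by
  have hK' : (0 : ℝ) < K := by exact_mod_cast hK
  rw [hs.gradient_globalLoss, hs.gradient_globalLoss, ← smul_sub, ← Finset.sum_sub_distrib,
    norm_smul, Real.norm_of_nonneg (by positivity), inv_mul_le_iff₀ hK']
  refine (norm_sum_le _ _).trans ((Finset.sum_le_sum fun k _ => (hs k).2 w u).trans_eq ?_)
  simp

theorem transProb_le_one (S : System d K Ξ) (k : Fin K) : S.transProb k ≤ 1 := by
  have := S.fading_prob k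
  exact measureReal_le_one

/-! ### Moments of the noise and of the stochastic gradients -/

namespace Run

variable {Ω : Type*} {R : S.Run Ω} [MeasurableSpace Ω] {μ : Measure Ω} {σl : ℝ} {Bk : Fin K → ℝ}

theorem measurable_theta (hM : R.IsModel μ) (η : ℝ) (t : ℕ) : Measurable (R.theta η t) :=
  (measurable_state_model hM η t).fst

theorem measurable_virtual (hM : R.IsModel μ) (η : ℝ) (t : ℕ) : Measurable (R.virtual η t) :=
  measurable_virtual_of (measurable_state_model hM η t)

theorem measurable_memory (hM : R.IsModel μ) (η : ℝ) (t : ℕ) (k : Fin K) :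
    Measurable (R.memory η t k) :=
  measurable_memory_of (measurable_state_model hM η t) k

theorem measurable_localTheta (hM : R.IsModel μ) (η : ℝ) (t : ℕ) (k : Fin K) (q : ℕ) :
    Measurable (R.localTheta η t k q) :=
  measurable_localTheta_of hM.batch_subset (measurable_state_model hM η t)
    fun q _ => hM.batch_measurable t k q

theorem measurable_localGrad (hM : R.IsModel μ) (η : ℝ) (t : ℕ) (k : Fin K) (q : ℕ) :
    Measurable (R.localGrad η t k q) :=
  S.measurable_stochGrad_comp (hM.batch_measurable t k q) (hM.batch_subset t k q)
    (measurable_localTheta hM η t k q)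

theorem memLp_n (hM : R.IsModel μ) (t : ℕ) (j : Fin d) : MemLp (R.n t j) 2 μ := by
  have h : MemLp id 2 (μ.map (R.n t j)) := by
    rw [hM.n_law]; exact memLp_id_gaussianReal 2
  exact (memLp_map_measure_iff aestronglyMeasurable_id
    (hM.n_measurable t j).aemeasurable).1 h

theorem integral_n (hM : R.IsModel μ) (t : ℕ) (j : Fin d) : ∫ ω, R.n t j ω ∂μ = 0 := by
  have h := integral_map (μ := μ) (φ := R.n t j) (hM.n_measurable t j).aemeasurable
    (f := fun x => x) aestronglyMeasurable_id
  rw [← h, hM.n_law, integral_id_gaussianReal]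

theorem integral_n_sq (hM : R.IsModel μ) (t : ℕ) (j : Fin d) :
    ∫ ω, R.n t j ω ^ 2 ∂μ = (S.σ : ℝ) ^ 2 := by
  have h := integral_map (μ := μ) (φ := R.n t j) (hM.n_measurable t j).aemeasurable
    (f := fun x => x ^ 2) (by fun_prop)
  rw [← h, hM.n_law]
  have hv := variance_fun_id_gaussianReal (μ := 0) (v := S.σ ^ 2)
  rw [variance_of_integral_eq_zero (by fun_prop) integral_id_gaussianReal] at hv
  simpa using hv

theorem memLp_noise (hM : R.IsModel μ) (t : ℕ) : MemLp (R.noise t) 2 μ := by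
  refine (memLp_two_iff_integrable_sq_norm ?_).2 ?_
  · exact ((WithLp.measurable_toLp _ _).comp
      (measurable_pi_lambda _ fun j => hM.n_measurable t j)).aestronglyMeasurable
  · simp_rw [EuclideanSpace.real_norm_sq_eq]
    exact integrable_finsetSum _ fun j _ => (memLp_n hM t j).integrable_sq

theorem integral_norm_noise_sq (hM : R.IsModel μ) (t : ℕ) :
    ∫ ω, ‖R.noise t ω‖ ^ 2 ∂μ = d * (S.σ : ℝ) ^ 2 := by
  simp_rw [EuclideanSpace.real_norm_sq_eq, noise]
  rw [integral_finsetSum _ fun j _ => (memLp_n hM t j).integrable_sq]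
  simp_rw [integral_n_sq hM]
  simp

variable [IsProbabilityMeasure μ]

theorem integrable_stochGrad_batch (hM : R.IsModel μ) (t : ℕ) (k : Fin K) (q : ℕ) (θ : Param d) :
    Integrable (fun ω => S.stochGrad (R.batch t k q ω) θ) μ :=
  (integral_comp_finite (s := (S.data k).powerset)
    (fun ω => Finset.mem_powerset.2 (hM.batch_subset t k q ω))
    (fun b _ => measurableSet_eq_of_subset (hM.batch_measurable t k q) (hM.batch_subset t k q) b)
    fun b => S.stochGrad b θ).1

/-- A mini-batch that is drawn with positive probability has a bounded gradient, because the
second moment is bounded uniformly in `θ` and there are finitely many mini-batches. -/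
theorem exists_bound_stochGrad (hM : R.IsModel μ) (hB : R.BoundedMoments μ σl Bk)
    (t : ℕ) (k : Fin K) (q : ℕ) : ∃ C : ℝ,
      (∀ b ∈ (S.data k).powerset, μ.real {ω | R.batch t k q ω = b} ≠ 0 →
        ∀ θ, ‖S.stochGrad b θ‖ ≤ C) ∧
      (∀ᵐ ω ∂μ, ∀ θ, ‖S.stochGrad (R.batch t k q ω) θ‖ ≤ C) := by
  have hmem : ∀ ω, R.batch t k q ω ∈ (S.data k).powerset := fun ω =>
    Finset.mem_powerset.2 (hM.batch_subset t k q ω)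
  have hms : ∀ b ∈ (S.data k).powerset, MeasurableSet {ω | R.batch t k q ω = b} := fun b _ =>
    measurableSet_eq_of_subset (hM.batch_measurable t k q) (hM.batch_subset t k q) b
  set p : Finset Ξ → ℝ := fun b => μ.real {ω | R.batch t k q ω = b} with hp
  have hp0 : ∀ b, 0 ≤ p b := fun b => measureReal_nonneg
  set C : ℝ := ∑ b ∈ (S.data k).powerset, √(Bk k ^ 2 / p b) with hC
  have h1 : ∀ b ∈ (S.data k).powerset, p b ≠ 0 → ∀ θ, ‖S.stochGrad b θ‖ ≤ C := by
    intro b hb hpb θ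
    have hpos : 0 < p b := lt_of_le_of_ne (hp0 b) hpb.symm
    have h2 : p b * ‖S.stochGrad b θ‖ ^ 2 ≤ Bk k ^ 2 := by
      refine le_trans ?_ (hB t k q θ).2.2
      rw [(integral_comp_finite hmem hms fun b => ‖S.stochGrad b θ‖ ^ 2).2]
      exact Finset.single_le_sum (f := fun b => p b • ‖S.stochGrad b θ‖ ^ 2)
        (fun b _ => smul_nonneg (hp0 b) (sq_nonneg _)) hb
    refine le_trans (Real.le_sqrt_of_sq_le ?_) (Finset.single_le_sum
      (f := fun b => √(Bk k ^ 2 / p b)) (fun b _ => Real.sqrt_nonneg _) hb)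
    rw [le_div_iff₀ hpos]
    linarith
  refine ⟨C, h1, ?_⟩
  have h3 : ∀ᵐ ω ∂μ, ∀ b ∈ (S.data k).powerset, p b = 0 → R.batch t k q ω ≠ b := by
    rw [Filter.eventually_all_finset]
    intro b _
    by_cases hpb : p b = 0
    · have : μ {ω | R.batch t k q ω = b} = 0 := by
        simpa [hp, Measure.real, ENNReal.toReal_eq_zero_iff] using hpb
      filter_upwards [measure_eq_zero_iff_ae_notMem.1 this] with ω hω _ using hω
    · exact Filter.Eventually.of_forall fun ω h => absurd h hpb
  filter_upwards [h3] with ω hω θ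
  exact h1 _ (hmem ω) (fun h => hω _ (hmem ω) h rfl) θ

theorem exists_bound_gradient_localLoss (hM : R.IsModel μ) (hB : R.BoundedMoments μ σl Bk)
    (k : Fin K) : ∃ C : ℝ, ∀ θ, ‖∇ (S.localLoss k) θ‖ ≤ C := by
  obtain ⟨C, -, hC⟩ := exists_bound_stochGrad hM hB 0 k 0
  refine ⟨C, fun θ => ?_⟩
  rw [← (hB 0 k 0 θ).1]
  simpa using norm_integral_le_of_norm_le_const (hC.mono fun ω h => h θ)

theorem memLp_gradient_localLoss (hM : R.IsModel μ) (hB : R.BoundedMoments μ σl Bk)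
    (k : Fin K) {θ : Ω → Param d} (hθ : Measurable θ) :
    MemLp (fun ω => ∇ (S.localLoss k) (θ ω)) 2 μ := by
  obtain ⟨C, hC⟩ := exists_bound_gradient_localLoss hM hB k
  exact MemLp.of_bound ((measurable_gradient _).comp hθ).aestronglyMeasurable C
    (Filter.Eventually.of_forall fun ω => hC _)

theorem memLp_gradient_globalLoss {Lk : Fin K → ℝ} (hs : S.LSmooth Lk) (hM : R.IsModel μ)
    (hB : R.BoundedMoments μ σl Bk) {θ : Ω → Param d} (hθ : Measurable θ) :
    MemLp (fun ω => ∇ S.globalLoss (θ ω)) 2 μ := by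
  simp_rw [hs.gradient_globalLoss]
  exact (memLp_finsetSum _ fun k _ => memLp_gradient_localLoss hM hB k hθ).const_smul (K : ℝ)⁻¹

/-- The mini-batch of a local step may be replaced by an independent copy in the expectation of
any function of it and of quantities that do not depend on it. -/
theorem integral_batch_decouple (hM : R.IsModel μ) (t : ℕ) (k : Fin K) (q : ℕ)
    (Z : Finset Ξ → Ω → ℝ)
    (hZ : ∀ b ∈ (S.data k).powerset, Measurable[R.exceptBatch (t, k, q)] (Z b))
    (hint : ∀ b ∈ (S.data k).powerset, μ.real {ω | R.batch t k q ω = b} ≠ 0 →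
      Integrable (Z b) μ) :
    Integrable (fun ω => Z (R.batch t k q ω) ω) μ ∧
      ∫ ω, Z (R.batch t k q ω) ω ∂μ = ∫ ω, ∫ ω', Z (R.batch t k q ω') ω ∂μ ∂μ := by
  refine integral_comp_of_indep_finite (batchSigma_le hM (t, k, q))
    (indep_exceptBatch hM (t, k, q)) (R.batch t k q) (S.data k).powerset
    (fun ω => Finset.mem_powerset.2 (hM.batch_subset t k q ω)) (fun b _ => ?_) Z hZ hint
  exact @measurableSet_eq_of_subset Ξ Ω (R.batchSigma (t, k, q)) _ (comap_measurable _) _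
    (hM.batch_subset t k q) b

theorem memLp_localGrad (hM : R.IsModel μ) (hB : R.BoundedMoments μ σl Bk) (η : ℝ) (t : ℕ)
    (k : Fin K) (q : ℕ) : MemLp (R.localGrad η t k q) 2 μ := by
  obtain ⟨C, -, hC⟩ := exists_bound_stochGrad hM hB t k q
  exact MemLp.of_bound (measurable_localGrad hM η t k q).aestronglyMeasurable C
    (hC.mono fun ω h => h _)

theorem memLp_stochGrad_localTheta (hM : R.IsModel μ) (hB : R.BoundedMoments μ σl Bk) (η : ℝ)
    (t : ℕ) (k : Fin K) (q : ℕ) {b : Finset Ξ} (hb : b ∈ (S.data k).powerset)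
    (hpb : μ.real {ω | R.batch t k q ω = b} ≠ 0) :
    MemLp (fun ω => S.stochGrad b (R.localTheta η t k q ω)) 2 μ := by
  obtain ⟨C, hC, -⟩ := exists_bound_stochGrad hM hB t k q
  exact MemLp.of_bound ((S.measurable_stochGrad b).comp
    (measurable_localTheta hM η t k q)).aestronglyMeasurable C
    (Filter.Eventually.of_forall fun ω => hC b hb hpb _)

theorem integral_norm_localGrad_sq_le (hM : R.IsModel μ) (hB : R.BoundedMoments μ σl Bk) (η : ℝ)
    (t : ℕ) (k : Fin K) (q : ℕ) : ∫ ω, ‖R.localGrad η t k q ω‖ ^ 2 ∂μ ≤ Bk k ^ 2 := by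
  have h := (integral_batch_decouple hM t k q
    (fun b ω => ‖S.stochGrad b (R.localTheta η t k q ω)‖ ^ 2) (fun b _ =>
      (((S.measurable_stochGrad b).norm).pow_const 2).comp
        (measurable_localTheta_exceptBatch hM η t k q))
    (fun b hb hpb => (memLp_stochGrad_localTheta hM hB η t k q hb hpb).integrable_norm_pow
      two_ne_zero)).2
  refine h.trans_le ?_
  refine (integral_mono_of_nonneg (Filter.Eventually.of_forall fun ω => ?_)
    (integrable_const (Bk k ^ 2)) (Filter.Eventually.of_forall fun ω => ?_)).trans_eq (by simp)
  · exact integral_nonneg fun _ => sq_nonneg _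
  · exact (hB t k q _).2.2

theorem integral_norm_localGrad_sub_sq_le (hM : R.IsModel μ) (hB : R.BoundedMoments μ σl Bk)
    (η : ℝ) (t : ℕ) (k : Fin K) (q : ℕ) :
    ∫ ω, ‖R.localGrad η t k q ω - ∇ (S.localLoss k) (R.localTheta η t k q ω)‖ ^ 2 ∂μ
      ≤ σl ^ 2 := by
  have h := (integral_batch_decouple hM t k q
    (fun b ω => ‖S.stochGrad b (R.localTheta η t k q ω) -
      ∇ (S.localLoss k) (R.localTheta η t k q ω)‖ ^ 2) (fun b _ =>
      ((((S.measurable_stochGrad b).sub (measurable_gradient _)).norm).pow_const 2).comp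
        (measurable_localTheta_exceptBatch hM η t k q))
    (fun b hb hpb => ((memLp_stochGrad_localTheta hM hB η t k q hb hpb).sub
      (memLp_gradient_localLoss hM hB k (measurable_localTheta hM η t k q))).integrable_norm_pow
      two_ne_zero)).2
  refine h.trans_le ?_
  refine (integral_mono_of_nonneg (Filter.Eventually.of_forall fun ω => ?_)
    (integrable_const (σl ^ 2)) (Filter.Eventually.of_forall fun ω => ?_)).trans_eq (by simp)
  · exact integral_nonneg fun _ => sq_nonneg _
  · exact (hB t k q _).2.1

theorem integral_inner_localGrad (hM : R.IsModel μ) (hB : R.BoundedMoments μ σl Bk)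
    (η : ℝ) (t : ℕ) (k : Fin K) (q : ℕ) {W : Ω → Param d}
    (hW : Measurable[R.exceptBatch (t, k, q)] W) (hW2 : MemLp W 2 μ) :
    ∫ ω, inner ℝ (W ω) (R.localGrad η t k q ω) ∂μ =
      ∫ ω, inner ℝ (W ω) (∇ (S.localLoss k) (R.localTheta η t k q ω)) ∂μ := by
  have h := (integral_batch_decouple hM t k q
    (fun b ω => inner ℝ (W ω) (S.stochGrad b (R.localTheta η t k q ω))) (fun b _ =>
      hW.inner ((S.measurable_stochGrad b).comp (measurable_localTheta_exceptBatch hM η t k q)))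
    (fun b hb hpb => integrable_inner_of_memLp_two hW2
      (memLp_stochGrad_localTheta hM hB η t k q hb hpb))).2
  refine h.trans (integral_congr_ae (Filter.Eventually.of_forall fun ω => ?_))
  simp only
  rw [integral_inner (integrable_stochGrad_batch hM t k q _), (hB t k q _).1]

/-! ### Square integrability of the iterates -/

theorem memLp_delta (hM : R.IsModel μ) (hB : R.BoundedMoments μ σl Bk) (η : ℝ) (t : ℕ)
    (k : Fin K) : MemLp (R.delta η t k) 2 μ := by
  have h := (memLp_finsetSum (Finset.range S.Q) fun q _ =>
    memLp_localGrad hM hB η t k q).const_smul η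
  exact h.congr_norm (measurable_delta_of hM.batch_subset (measurable_state_model hM η t)
    fun q => hM.batch_measurable t k q).aestronglyMeasurable
    (Filter.Eventually.of_forall fun ω => by simp [delta_eq])

theorem memLp_avgDelta (hM : R.IsModel μ) (hB : R.BoundedMoments μ σl Bk) (η : ℝ) (t : ℕ) :
    MemLp (R.avgDelta η t) 2 μ :=
  (memLp_finsetSum Finset.univ fun k _ => memLp_delta hM hB η t k).const_smul (K : ℝ)⁻¹

theorem memLp_memory (hM : R.IsModel μ) (hB : R.BoundedMoments μ σl Bk) (η : ℝ) (t : ℕ)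
    (k : Fin K) : MemLp (R.memory η t k) 2 μ := by
  induction t with
  | zero => exact MemLp.zero'
  | succ t ih =>
    exact (ih.add (memLp_delta hM hB η t k)).mono
      (measurable_memory hM η (t + 1) k).aestronglyMeasurable
      (Filter.Eventually.of_forall fun ω => R.norm_memory_succ_le η t k ω)

theorem integral_inner_noise (hM : R.IsModel μ) (t : ℕ) {W : Ω → Param d}
    (hW : ∀ j, Measurable[R.exceptNoise (t, j)] W) (hW2 : MemLp W 2 μ) :
    ∫ ω, inner ℝ (W ω) (R.noise t ω) ∂μ = 0 := by
  have hWj : ∀ j, MemLp (fun ω => W ω j) 2 μ := fun j => hW2.mono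
    (by have := hW2.1; fun_prop) (Filter.Eventually.of_forall fun ω => PiLp.norm_apply_le _ _)
  have hi : ∀ j, IndepFun (fun ω => W ω j) (R.n t j) μ := fun j => by
    refine (indep_of_indep_of_le_right (indep_exceptNoise hM (t, j)) ?_).symm
    have hmeas : Measurable fun v : Param d => v j := by fun_prop
    exact (hmeas.comp (hW j)).comap_le
  have e : ∀ ω, inner ℝ (W ω) (R.noise t ω) = ∑ j, W ω j * R.n t j ω := fun ω => by
    simp [PiLp.inner_apply, noise, mul_comm]
  simp_rw [e]
  have hp : ∀ j, Integrable (fun ω => W ω j * R.n t j ω) μ := fun j =>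
    (hWj j).integrable_mul (memLp_n hM t j)
  rw [integral_finsetSum _ fun j _ => hp j]
  refine Finset.sum_eq_zero fun j _ => ?_
  rw [(hi j).integral_fun_mul_eq_mul_integral (hWj j).1 (memLp_n hM t j).1, integral_n hM, mul_zero]

theorem memLp_virtual (hM : R.IsModel μ) (hB : R.BoundedMoments μ σl Bk) {η : ℝ} (hη : 0 < η)
    (t : ℕ) (hρ : ∀ s < t, 0 < R.ρ s) : MemLp (R.virtual η t) 2 μ := by
  induction t with
  | zero =>
    exact (memLp_const (μ := μ) S.θ₀).congr_norm (measurable_virtual hM η 0).aestronglyMeasurable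
      (Filter.Eventually.of_forall fun ω => by rw [virtual_zero])
  | succ t ih =>
    have h := (ih fun s hs => hρ s (by omega)).add
      ((memLp_avgDelta hM hB η t).add ((memLp_noise hM t).const_smul (η / (√(R.ρ t) * K)))).neg
    exact h.congr_norm (measurable_virtual hM η (t + 1)).aestronglyMeasurable
      (Filter.Eventually.of_forall fun ω => by
        simp [R.virtual_succ hη (hρ t (by omega))])

end Run

end System

namespace System.Run

variable {d K : ℕ} {Ξ : Type*} {S : System d K Ξ} {Ω : Type*} {R : S.Run Ω} [MeasurableSpace Ω]
  {μ : Measure Ω} {σl : ℝ} {Bk : Fin K → ℝ}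

/-! ### Mask and transmit power -/

theorem integral_mask (hM : R.IsModel μ) (t : ℕ) (k : Fin K) (j : Fin d) :
    ∫ ω, S.mask k (R.h t k j ω) ∂μ = S.transProb k := by
  have h := integral_map (μ := μ) (φ := R.h t k j) (hM.h_measurable t k j).aemeasurable
    (f := S.mask k) (S.measurable_mask k).aestronglyMeasurable
  have hset : MeasurableSet {z : ℂ | S.ε k ≤ ‖z‖ ^ 2} :=
    measurableSet_le measurable_const (measurable_norm.pow_const 2)
  have hmask : S.mask k = {z : ℂ | S.ε k ≤ ‖z‖ ^ 2}.indicator 1 := by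
    classical
    funext z
    simp [mask, Set.indicator]
  rw [← h, hM.h_law, hmask, integral_indicator_one hset]
  rfl

theorem integrable_mask_mul (hM : R.IsModel μ) (t : ℕ) (k : Fin K) (j : Fin d) {Z : Ω → ℝ}
    (hZi : Integrable Z μ) : Integrable (fun ω => S.mask k (R.h t k j ω) * Z ω) μ :=
  hZi.mono ((((S.measurable_mask k).comp (hM.h_measurable t k j)).aestronglyMeasurable).mul hZi.1)
    (Filter.Eventually.of_forall fun ω => by
      rw [norm_mul, Real.norm_of_nonneg (S.mask_nonneg k _)]
      exact mul_le_of_le_one_left (norm_nonneg _) (S.mask_le_one k _))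

theorem power_eq (R : S.Run Ω) (η : ℝ) (t : ℕ) (k : Fin K) {r : ℝ} (hr : 0 ≤ r) :
    R.power μ η t k r = r * ((d : ℝ)⁻¹ * ∫ ω, ∑ j, (S.κ k * ‖R.h t k j ω‖ ^ 2)⁻¹ *
      S.mask k (R.h t k j ω) * R.x η t k ω j ^ 2 ∂μ) := by
  have e : ∀ ω, ∑ j, ‖S.powerFactor r k (R.h t k j ω) * (S.mask k (R.h t k j ω) : ℂ) *
      (R.x η t k ω j : ℂ)‖ ^ 2 = r * ∑ j, (S.κ k * ‖R.h t k j ω‖ ^ 2)⁻¹ *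
      S.mask k (R.h t k j ω) * R.x η t k ω j ^ 2 := fun ω => by
    rw [Finset.mul_sum]
    refine Finset.sum_congr rfl fun j _ => ?_
    rw [norm_mul, norm_mul, mul_pow, mul_pow, S.norm_powerFactor_sq hr, Complex.norm_real,
      Complex.norm_real, Real.norm_eq_abs, Real.norm_eq_abs, sq_abs, sq_abs, mask_sq]
    ring
  unfold power
  simp_rw [e]
  rw [integral_const_mul]
  ring

variable [IsProbabilityMeasure μ]

/-! ### The memories -/

theorem integral_norm_delta_sq_le (hM : R.IsModel μ) (hB : R.BoundedMoments μ σl Bk) (η : ℝ)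
    (t : ℕ) (k : Fin K) : ∫ ω, ‖R.delta η t k ω‖ ^ 2 ∂μ ≤ (η * S.Q * Bk k) ^ 2 := by
  have hi : ∀ q, Integrable (fun ω => ‖R.localGrad η t k q ω‖ ^ 2) μ := fun q =>
    (memLp_localGrad hM hB η t k q).integrable_norm_pow two_ne_zero
  have hpt : ∀ ω, ‖R.delta η t k ω‖ ^ 2 ≤
      η ^ 2 * (S.Q * ∑ q ∈ Finset.range S.Q, ‖R.localGrad η t k q ω‖ ^ 2) := fun ω => by
    have h := norm_sum_sq_le (Finset.range S.Q) fun q => R.localGrad η t k q ω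
    rw [Finset.card_range] at h
    rw [delta_eq, norm_smul, mul_pow, Real.norm_eq_abs, sq_abs]
    gcongr
  calc ∫ ω, ‖R.delta η t k ω‖ ^ 2 ∂μ
      ≤ ∫ ω, η ^ 2 * (S.Q * ∑ q ∈ Finset.range S.Q, ‖R.localGrad η t k q ω‖ ^ 2) ∂μ :=
        integral_mono ((memLp_delta hM hB η t k).integrable_norm_pow two_ne_zero)
          (((integrable_finsetSum _ fun q _ => hi q).const_mul _).const_mul _) hpt
    _ = η ^ 2 * (S.Q * ∑ q ∈ Finset.range S.Q, ∫ ω, ‖R.localGrad η t k q ω‖ ^ 2 ∂μ) := by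
        rw [integral_const_mul, integral_const_mul, integral_finsetSum _ fun q _ => hi q]
    _ ≤ η ^ 2 * (S.Q * ∑ q ∈ Finset.range S.Q, Bk k ^ 2) := by
        gcongr with q _
        exact integral_norm_localGrad_sq_le hM hB η t k q
    _ = (η * S.Q * Bk k) ^ 2 := by
        rw [Finset.sum_const, Finset.card_range, nsmul_eq_mul]; ring

theorem integral_mask_mul (hM : R.IsModel μ) (t : ℕ) (k : Fin K) (j : Fin d) {Z : Ω → ℝ}
    (hZ : Measurable[R.exceptFading (t, j)] Z) (hZi : Integrable Z μ) :
    ∫ ω, S.mask k (R.h t k j ω) * Z ω ∂μ = S.transProb k * ∫ ω, Z ω ∂μ := by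
  have hi : IndepFun (fun ω => S.mask k (R.h t k j ω)) Z μ := by
    refine indep_of_indep_of_le_left (indep_of_indep_of_le_right
      (indep_exceptFading hM (t, j)) hZ.comap_le) ?_
    have h := comap_measurable (m := MeasurableSpace.pi) (fun ω (k : Fin K) => R.h t k j ω)
    exact ((S.measurable_mask k).comp ((measurable_pi_apply k).comp h)).comap_le
  rw [hi.integral_fun_mul_eq_mul_integral
    ((S.measurable_mask k).comp (hM.h_measurable t k j)).aestronglyMeasurable hZi.1,
    integral_mask hM]

theorem memLp_compensated (hM : R.IsModel μ) (hB : R.BoundedMoments μ σl Bk) (η : ℝ) (t : ℕ)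
    (k : Fin K) : MemLp (fun ω => R.memory η t k ω + R.delta η t k ω) 2 μ :=
  (memLp_memory hM hB η t k).add (memLp_delta hM hB η t k)

theorem integrable_compensated_apply_sq (hM : R.IsModel μ) (hB : R.BoundedMoments μ σl Bk)
    (η : ℝ) (t : ℕ) (k : Fin K) (j : Fin d) :
    Integrable (fun ω => (R.memory η t k ω + R.delta η t k ω) j ^ 2) μ := by
  have h := memLp_compensated hM hB η t k
  have hj : MemLp (fun ω => (R.memory η t k ω + R.delta η t k ω) j) 2 μ :=
    h.mono (by have := h.1; fun_prop) (Filter.Eventually.of_forall fun ω => PiLp.norm_apply_le _ _)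
  exact hj.integrable_sq

theorem integral_mask_mul_compensated (hM : R.IsModel μ) (hB : R.BoundedMoments μ σl Bk)
    (η : ℝ) (t : ℕ) (k : Fin K) :
    ∑ j, ∫ ω, S.mask k (R.h t k j ω) * (R.memory η t k ω + R.delta η t k ω) j ^ 2 ∂μ =
      S.transProb k * ∫ ω, ‖R.memory η t k ω + R.delta η t k ω‖ ^ 2 ∂μ := by
  have hi := integrable_compensated_apply_sq hM hB η t k
  simp_rw [EuclideanSpace.real_norm_sq_eq]
  rw [integral_finsetSum _ fun j _ => hi j, Finset.mul_sum]
  refine Finset.sum_congr rfl fun j _ => integral_mask_mul hM t k j ?_ (hi j)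
  have hmeas : Measurable fun v : Param d => v j ^ 2 := by fun_prop
  exact hmeas.comp (measurable_compensated_exceptFading hM η t k j)

theorem integral_norm_memory_succ_sq (hM : R.IsModel μ) (hB : R.BoundedMoments μ σl Bk)
    (η : ℝ) (t : ℕ) (k : Fin K) : ∫ ω, ‖R.memory η (t + 1) k ω‖ ^ 2 ∂μ =
      (1 - S.transProb k) * ∫ ω, ‖R.memory η t k ω + R.delta η t k ω‖ ^ 2 ∂μ := by
  have hi := integrable_compensated_apply_sq hM hB η t k
  have e : ∀ ω, ‖R.memory η (t + 1) k ω‖ ^ 2 = ‖R.memory η t k ω + R.delta η t k ω‖ ^ 2 -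
      ∑ j, S.mask k (R.h t k j ω) * (R.memory η t k ω + R.delta η t k ω) j ^ 2 := fun ω => by
    rw [norm_memory_succ_sq, EuclideanSpace.real_norm_sq_eq, ← Finset.sum_sub_distrib]
    exact Finset.sum_congr rfl fun j _ => by ring
  simp_rw [e]
  rw [integral_sub ((memLp_compensated hM hB η t k).integrable_norm_pow two_ne_zero)
    (integrable_finsetSum _ fun j _ => integrable_mask_mul hM t k j (hi j)),
    integral_finsetSum _ fun j _ => integrable_mask_mul hM t k j (hi j),
    integral_mask_mul_compensated hM hB]
  ring

theorem integral_norm_memory_sq_le (hM : R.IsModel μ) (hB : R.BoundedMoments μ σl Bk) (η : ℝ)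
    {k : Fin K} (hk : 0 < S.transProb k) (t : ℕ) : ∫ ω, ‖R.memory η t k ω‖ ^ 2 ∂μ ≤
      contractionConst (S.transProb k) * (η * S.Q * Bk k) ^ 2 := by
  have hk1 := S.transProb_le_one k
  induction t with
  | zero =>
    have := contractionConst_nonneg hk hk1
    simp only [memory_zero, norm_zero]
    rw [zero_pow two_ne_zero, integral_zero]
    positivity
  | succ t ih =>
    have hm := (memLp_memory hM hB η t k).integrable_norm_pow two_ne_zero
    have hδ := (memLp_delta hM hB η t k).integrable_norm_pow two_ne_zero
    have hc : 0 ≤ (1 - S.transProb k) * (2 - S.transProb k) / S.transProb k :=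
      div_nonneg (mul_nonneg (by linarith) (by linarith)) hk.le
    rw [integral_norm_memory_succ_sq hM hB, ← integral_const_mul]
    calc ∫ ω, (1 - S.transProb k) * ‖R.memory η t k ω + R.delta η t k ω‖ ^ 2 ∂μ
        ≤ ∫ ω, ((1 - S.transProb k / 2) * ‖R.memory η t k ω‖ ^ 2 +
          (1 - S.transProb k) * (2 - S.transProb k) / S.transProb k *
            ‖R.delta η t k ω‖ ^ 2) ∂μ :=
          integral_mono
            (((memLp_compensated hM hB η t k).integrable_norm_pow two_ne_zero).const_mul _)
            ((hm.const_mul _).add (hδ.const_mul _))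
            fun ω => mul_norm_add_sq_le_contraction _ _ hk hk1
      _ = (1 - S.transProb k / 2) * ∫ ω, ‖R.memory η t k ω‖ ^ 2 ∂μ +
          (1 - S.transProb k) * (2 - S.transProb k) / S.transProb k *
            ∫ ω, ‖R.delta η t k ω‖ ^ 2 ∂μ := by
          rw [integral_add (hm.const_mul _) (hδ.const_mul _), integral_const_mul,
            integral_const_mul]
      _ ≤ (1 - S.transProb k / 2) * ∫ ω, ‖R.memory η t k ω‖ ^ 2 ∂μ +
          (1 - S.transProb k) * (2 - S.transProb k) / S.transProb k * (η * S.Q * Bk k) ^ 2 := by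
          gcongr
          exact integral_norm_delta_sq_le hM hB η t k
      _ ≤ _ := contractionConst_step hk hk1 (sq_nonneg _) ih

theorem integral_norm_compensated_sq_le (hM : R.IsModel μ) (hB : R.BoundedMoments μ σl Bk)
    (η : ℝ) {k : Fin K} (hk : 0 < S.transProb k) (t : ℕ) :
    ∫ ω, ‖R.memory η t k ω + R.delta η t k ω‖ ^ 2 ∂μ ≤
      2 * (contractionConst (S.transProb k) + 1) * (η * S.Q * Bk k) ^ 2 := by
  have hm := (memLp_memory hM hB η t k).integrable_norm_pow two_ne_zero
  have hδ := (memLp_delta hM hB η t k).integrable_norm_pow two_ne_zero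
  calc ∫ ω, ‖R.memory η t k ω + R.delta η t k ω‖ ^ 2 ∂μ
      ≤ ∫ ω, (2 * ‖R.memory η t k ω‖ ^ 2 + 2 * ‖R.delta η t k ω‖ ^ 2) ∂μ :=
        integral_mono ((memLp_compensated hM hB η t k).integrable_norm_pow two_ne_zero)
          ((hm.const_mul _).add (hδ.const_mul _)) fun ω => norm_add_sq_le_two _ _
    _ = 2 * ∫ ω, ‖R.memory η t k ω‖ ^ 2 ∂μ + 2 * ∫ ω, ‖R.delta η t k ω‖ ^ 2 ∂μ := by
        rw [integral_add (hm.const_mul _) (hδ.const_mul _), integral_const_mul,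
          integral_const_mul]
    _ ≤ _ := by
        have h1 := integral_norm_memory_sq_le hM hB η hk t
        have h2 := integral_norm_delta_sq_le hM hB η t k
        linarith

/-! ### The power scaling -/

/-- The power constraint of some device is active at the largest admissible scaling, which bounds
that scaling from below. -/
theorem exists_div_rho_le (hM : R.IsModel μ) (hB : R.BoundedMoments μ σl Bk) {η : ℝ}
    (hη : 0 < η) (hd : 0 < d) (hK : 0 < K) (htrans : ∀ k, 0 < S.transProb k) {t : ℕ}
    (hρ : IsGreatest {r : ℝ | 0 < r ∧ ∀ k, R.power μ η t k r ≤ S.P k} (R.ρ t)) :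
    ∃ k, d / R.ρ t ≤ 2 * S.Q * (S.transProb k * Bk k ^ 2 * S.Q *
      (contractionConst (S.transProb k) + 1) / (S.P k * S.κ k * S.ε k)) := by
  have : Nonempty (Fin K) := ⟨⟨0, hK⟩⟩
  have hd' : (0 : ℝ) < d := by exact_mod_cast hd
  have hρ0 : 0 < R.ρ t := hρ.1.1
  set J : Fin K → ℝ := fun k => ∫ ω, ∑ j, (S.κ k * ‖R.h t k j ω‖ ^ 2)⁻¹ *
      S.mask k (R.h t k j ω) * R.x η t k ω j ^ 2 ∂μ with hJ
  have hnn : ∀ k ω, 0 ≤ ∑ j, (S.κ k * ‖R.h t k j ω‖ ^ 2)⁻¹ *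
      S.mask k (R.h t k j ω) * R.x η t k ω j ^ 2 := fun k ω =>
    Finset.sum_nonneg fun j _ => mul_nonneg (mul_nonneg (inv_nonneg.2
      (mul_nonneg (S.κ_pos k).le (sq_nonneg _))) (S.mask_nonneg k _)) (sq_nonneg _)
  have hJ0 : ∀ k, 0 ≤ (d : ℝ)⁻¹ * J k := fun k =>
    mul_nonneg (by positivity) (integral_nonneg fun ω => hnn k ω)
  have hpow : ∀ k r, 0 ≤ r → R.power μ η t k r = r * ((d : ℝ)⁻¹ * J k) := fun k r hr =>
    R.power_eq η t k hr
  obtain ⟨k, hk⟩ : ∃ k, S.P k ≤ R.ρ t * ((d : ℝ)⁻¹ * J k) := by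
    by_contra! hlt
    -- every constraint leaves room for a larger scaling, hence so does their minimum
    have hroom : ∀ k, ∃ r, R.ρ t < r ∧ r * ((d : ℝ)⁻¹ * J k) ≤ S.P k := fun k => by
      rcases (hJ0 k).eq_or_lt with h0 | h0
      · exact ⟨R.ρ t + 1, by linarith, by rw [← h0, mul_zero]; exact (S.P_pos k).le⟩
      · exact ⟨S.P k / ((d : ℝ)⁻¹ * J k), (lt_div_iff₀ h0).2 (hlt k),
          (div_mul_cancel₀ _ h0.ne').le⟩
    choose r hr1 hr2 using hroom
    obtain ⟨k₀, hk₀⟩ := Finite.exists_min r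
    have hmem : r k₀ ∈ {r : ℝ | 0 < r ∧ ∀ k, R.power μ η t k r ≤ S.P k} := by
      have hpos : 0 < r k₀ := hρ0.trans (hr1 k₀)
      refine ⟨hpos, fun k => ?_⟩
      rw [hpow k _ hpos.le]
      exact (mul_le_mul_of_nonneg_right (hk₀ k) (hJ0 k)).trans (hr2 k)
    exact absurd (hρ.2 hmem) (not_le.2 (hr1 k₀))
  refine ⟨k, ?_⟩
  have hκ := S.κ_pos k
  have hε := S.ε_pos k
  have hP := S.P_pos k
  have hi := integrable_compensated_apply_sq hM hB η t k
  have hxj : ∀ ω j, R.x η t k ω j = η⁻¹ * (R.memory η t k ω + R.delta η t k ω) j := fun ω j => by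
    rw [x_eq, PiLp.smul_apply, smul_eq_mul]
  have hJle : J k ≤ (S.κ k * S.ε k)⁻¹ * (η⁻¹ ^ 2 * (S.transProb k *
      (2 * (contractionConst (S.transProb k) + 1) * (η * S.Q * Bk k) ^ 2))) := by
    have hmi : ∀ j, Integrable (fun ω => S.mask k (R.h t k j ω) *
        (R.memory η t k ω + R.delta η t k ω) j ^ 2) μ := fun j =>
      integrable_mask_mul hM t k j (hi j)
    calc J k ≤ ∫ ω, (S.κ k * S.ε k)⁻¹ * (η⁻¹ ^ 2 * ∑ j, S.mask k (R.h t k j ω) *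
          (R.memory η t k ω + R.delta η t k ω) j ^ 2) ∂μ := by
          refine integral_mono_of_nonneg (Filter.Eventually.of_forall fun ω => hnn k ω)
            (((integrable_finsetSum _ fun j _ => hmi j).const_mul _).const_mul _)
            (Filter.Eventually.of_forall fun ω => ?_)
          simp only
          rw [Finset.mul_sum, Finset.mul_sum]
          refine Finset.sum_le_sum fun j _ => ?_
          have h := mul_le_mul_of_nonneg_right (S.inv_mul_mask_le k (R.h t k j ω))
            (sq_nonneg (R.x η t k ω j))
          refine h.trans_eq ?_
          rw [hxj]
          ring
      _ = (S.κ k * S.ε k)⁻¹ * (η⁻¹ ^ 2 * (S.transProb k *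
          ∫ ω, ‖R.memory η t k ω + R.delta η t k ω‖ ^ 2 ∂μ)) := by
          rw [integral_const_mul, integral_const_mul, integral_finsetSum _ fun j _ => hmi j,
            integral_mask_mul_compensated hM hB]
      _ ≤ _ := by
          have := htrans k
          gcongr
          exact integral_norm_compensated_sq_le hM hB η this t
  have hfin : d * S.P k ≤ R.ρ t * ((S.κ k * S.ε k)⁻¹ * (η⁻¹ ^ 2 * (S.transProb k *
      (2 * (contractionConst (S.transProb k) + 1) * (η * S.Q * Bk k) ^ 2)))) := by
    calc d * S.P k ≤ d * (R.ρ t * ((d : ℝ)⁻¹ * J k)) := by gcongr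
      _ = R.ρ t * J k := by field_simp
      _ ≤ _ := by gcongr
  rw [div_le_iff₀ hρ0]
  calc (d : ℝ) = d * S.P k / S.P k := by field_simp
    _ ≤ R.ρ t * ((S.κ k * S.ε k)⁻¹ * (η⁻¹ ^ 2 * (S.transProb k *
      (2 * (contractionConst (S.transProb k) + 1) * (η * S.Q * Bk k) ^ 2)))) / S.P k := by gcongr
    _ = _ := by field_simp

/-! ### The local drift -/

theorem memLp_localTheta_sub (hM : R.IsModel μ) (hB : R.BoundedMoments μ σl Bk) (η : ℝ) (t : ℕ)
    (k : Fin K) (q : ℕ) : MemLp (fun ω => R.localTheta η t k q ω - R.theta η t ω) 2 μ := by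
  have h := (memLp_finsetSum (Finset.range q) fun q _ =>
    memLp_localGrad hM hB η t k q).const_smul η
  exact h.congr_norm ((measurable_localTheta hM η t k q).sub
    (measurable_theta hM η t)).aestronglyMeasurable
    (Filter.Eventually.of_forall fun ω => by simp [localTheta_eq])

/-- The variance of a local step adds up without cross term, because the mini-batch is
independent of the current local iterate. -/
theorem integral_norm_localTheta_succ_sub_sq_le (hM : R.IsModel μ)
    (hB : R.BoundedMoments μ σl Bk) (η : ℝ) (t : ℕ) (k : Fin K) (q : ℕ) :
    ∫ ω, ‖R.localTheta η t k (q + 1) ω - R.theta η t ω‖ ^ 2 ∂μ ≤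
      ∫ ω, ‖R.localTheta η t k q ω - R.theta η t ω -
        η • ∇ (S.localLoss k) (R.localTheta η t k q ω)‖ ^ 2 ∂μ + η ^ 2 * σl ^ 2 := by
  set W : Ω → Param d := fun ω => R.localTheta η t k q ω - R.theta η t ω -
    η • ∇ (S.localLoss k) (R.localTheta η t k q ω) with hW
  set X : Ω → Param d := fun ω => R.localGrad η t k q ω -
    ∇ (S.localLoss k) (R.localTheta η t k q ω) with hX
  have hG := memLp_gradient_localLoss hM hB k (measurable_localTheta hM η t k q)
  have hW2 : MemLp W 2 μ := (memLp_localTheta_sub hM hB η t k q).sub (hG.const_smul η)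
  have hX2 : MemLp X 2 μ := (memLp_localGrad hM hB η t k q).sub hG
  have hWm : Measurable[R.exceptBatch (t, k, q)] W := by
    have h1 := measurable_localTheta_exceptBatch hM η t k q
    have h2 := (measurable_state_exceptBatch hM η t k q).fst
    exact (h1.sub h2).sub (((measurable_gradient _).comp h1).const_smul η)
  have hcross : ∫ ω, inner ℝ (W ω) (X ω) ∂μ = 0 := by
    simp only [hX, inner_sub_right]
    rw [integral_sub (integrable_inner_of_memLp_two hW2 (memLp_localGrad hM hB η t k q))
      (integrable_inner_of_memLp_two hW2 hG), integral_inner_localGrad hM hB η t k q hWm hW2,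
      sub_self]
  have e : ∀ ω, ‖R.localTheta η t k (q + 1) ω - R.theta η t ω‖ ^ 2 =
      ‖W ω‖ ^ 2 - 2 * η * inner ℝ (W ω) (X ω) + η ^ 2 * ‖X ω‖ ^ 2 := fun ω => by
    have e1 : R.localTheta η t k (q + 1) ω - R.theta η t ω = W ω - η • X ω := by
      simp only [hW, hX, localTheta_succ, smul_sub]; abel
    rw [e1, norm_sub_sq_real, inner_smul_right, norm_smul, mul_pow, Real.norm_eq_abs, sq_abs]
    ring
  have iW := hW2.integrable_norm_pow two_ne_zero
  have iX := hX2.integrable_norm_pow two_ne_zero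
  have iWX := integrable_inner_of_memLp_two hW2 hX2
  simp_rw [e]
  have iWWX : Integrable (fun ω => ‖W ω‖ ^ 2 - 2 * η * inner ℝ (W ω) (X ω)) μ :=
    iW.sub (iWX.const_mul _)
  rw [integral_add iWWX (iX.const_mul _), integral_sub iW (iWX.const_mul _),
    integral_const_mul, integral_const_mul, hcross]
  have := integral_norm_localGrad_sub_sq_le hM hB η t k q
  have h2 := mul_le_mul_of_nonneg_left this (sq_nonneg η)
  linarith

/-- The drift recursion of `le_of_drift_recursion`, obtained by splitting the local gradient into
its change along the drift, the heterogeneity and `∇f(θ^{(t)})`. The Young parameter is `1 / Q`, and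
`ηQL ≤ 1 / 12` turns the factor into at most `1 + (25 / 24) / Q`. -/
theorem integral_norm_localTheta_sub_sq_le {L σg : ℝ} (hs : S.LSmooth fun _ => L) (hL : 0 ≤ L)
    (hhet : S.BoundedHeterogeneity σg) (hQ : 0 < S.Q) (hM : R.IsModel μ)
    (hB : R.BoundedMoments μ σl Bk) {η : ℝ} (hη : 0 < η) (hηL : η * S.Q * L ≤ 1 / 12) (t : ℕ)
    (k : Fin K) {q : ℕ} (hq : q ≤ S.Q) :
    ∫ ω, ‖R.localTheta η t k q ω - R.theta η t ω‖ ^ 2 ∂μ ≤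
      5 * S.Q * η ^ 2 * (σl ^ 2 + 6 * S.Q * σg ^ 2) +
        30 * S.Q ^ 2 * η ^ 2 * ∫ ω, ‖∇ S.globalLoss (R.theta η t ω)‖ ^ 2 ∂μ := by
  have hQ' : (0 : ℝ) < S.Q := by exact_mod_cast hQ
  have hQ1 : (1 : ℝ) ≤ S.Q := by exact_mod_cast hQ
  set G : ℝ := ∫ ω, ‖∇ S.globalLoss (R.theta η t ω)‖ ^ 2 ∂μ with hG
  have hG0 : 0 ≤ G := integral_nonneg fun ω => sq_nonneg _
  have hrec := le_of_drift_recursion hQ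
    (A := fun q => ∫ ω, ‖R.localTheta η t k q ω - R.theta η t ω‖ ^ 2 ∂μ)
    (b := 6 * S.Q * η ^ 2 * (σg ^ 2 + G) + η ^ 2 * σl ^ 2)
    (c := 1 + (S.Q : ℝ)⁻¹ + 6 * S.Q * η ^ 2 * L ^ 2) (by positivity) ?_ ?_
    (fun q => integral_nonneg fun ω => sq_nonneg _) ?_ q hq
  · refine hrec.trans_eq ?_
    ring
  · have h1 : (η * S.Q * L) ^ 2 ≤ (1 / 12) ^ 2 := by gcongr
    have h2 : 6 * S.Q * η ^ 2 * L ^ 2 = 6 * (η * S.Q * L) ^ 2 * (S.Q : ℝ)⁻¹ := by field_simp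
    rw [h2, div_eq_mul_inv]
    have h3 : 6 * (η * S.Q * L) ^ 2 * (S.Q : ℝ)⁻¹ ≤ 6 * (1 / 12) ^ 2 * (S.Q : ℝ)⁻¹ := by gcongr
    linarith
  · simp [localTheta_zero]
  · intro q _
    have hF := (memLp_gradient_globalLoss hs hM hB (measurable_theta hM η t)).integrable_norm_pow
      two_ne_zero
    have hu := (memLp_localTheta_sub hM hB η t k q).integrable_norm_pow two_ne_zero
    have hg := memLp_gradient_localLoss hM hB k (measurable_localTheta hM η t k q)
    have hpt : ∀ ω, ‖R.localTheta η t k q ω - R.theta η t ω -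
        η • ∇ (S.localLoss k) (R.localTheta η t k q ω)‖ ^ 2 ≤
        (1 + (S.Q : ℝ)⁻¹ + 6 * S.Q * η ^ 2 * L ^ 2) *
          ‖R.localTheta η t k q ω - R.theta η t ω‖ ^ 2 + 6 * S.Q * η ^ 2 * σg ^ 2 +
        6 * S.Q * η ^ 2 * ‖∇ S.globalLoss (R.theta η t ω)‖ ^ 2 := fun ω => by
      set θ := R.theta η t ω
      set θq := R.localTheta η t k q ω
      have h1 := norm_add_sq_le_young (θq - θ) (-(η • ∇ (S.localLoss k) θq))
        (inv_pos.2 hQ')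
      rw [← sub_eq_add_neg, norm_neg, inv_inv, norm_smul, mul_pow, Real.norm_eq_abs, sq_abs] at h1
      have h2 := norm_add_sq_le_three (∇ (S.localLoss k) θq - ∇ (S.localLoss k) θ)
        (∇ (S.localLoss k) θ - ∇ S.globalLoss θ) (∇ S.globalLoss θ)
      rw [show ∇ (S.localLoss k) θq - ∇ (S.localLoss k) θ +
        (∇ (S.localLoss k) θ - ∇ S.globalLoss θ) + ∇ S.globalLoss θ = ∇ (S.localLoss k) θq by
        abel] at h2
      have h3 : ‖∇ (S.localLoss k) θq - ∇ (S.localLoss k) θ‖ ^ 2 ≤ L ^ 2 * ‖θq - θ‖ ^ 2 := by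
        rw [← mul_pow]; gcongr; exact (hs k).2 θq θ
      have h4 := hhet k θ
      have h5 : (1 + (S.Q : ℝ)) * (η ^ 2 * ‖∇ (S.localLoss k) θq‖ ^ 2) ≤
          (2 * S.Q) * (η ^ 2 * (3 * (L ^ 2 * ‖θq - θ‖ ^ 2 + σg ^ 2 +
            ‖∇ S.globalLoss θ‖ ^ 2))) := by
        gcongr
        · linarith
        · exact h2.trans (by linarith)
      linarith
    refine (integral_norm_localTheta_succ_sub_sq_le hM hB η t k q).trans ?_
    have hint : ∫ ω, ‖R.localTheta η t k q ω - R.theta η t ω -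
        η • ∇ (S.localLoss k) (R.localTheta η t k q ω)‖ ^ 2 ∂μ ≤
        (1 + (S.Q : ℝ)⁻¹ + 6 * S.Q * η ^ 2 * L ^ 2) *
          ∫ ω, ‖R.localTheta η t k q ω - R.theta η t ω‖ ^ 2 ∂μ + 6 * S.Q * η ^ 2 * σg ^ 2 +
        6 * S.Q * η ^ 2 * G := by
      have i1 : Integrable (fun ω => (1 + (S.Q : ℝ)⁻¹ + 6 * S.Q * η ^ 2 * L ^ 2) *
          ‖R.localTheta η t k q ω - R.theta η t ω‖ ^ 2 + 6 * S.Q * η ^ 2 * σg ^ 2) μ :=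
        (hu.const_mul _).add (integrable_const _)
      have i2 : Integrable (fun ω => (1 + (S.Q : ℝ)⁻¹ + 6 * S.Q * η ^ 2 * L ^ 2) *
          ‖R.localTheta η t k q ω - R.theta η t ω‖ ^ 2 + 6 * S.Q * η ^ 2 * σg ^ 2 +
          6 * S.Q * η ^ 2 * ‖∇ S.globalLoss (R.theta η t ω)‖ ^ 2) μ :=
        i1.add (hF.const_mul _)
      refine (integral_mono (((memLp_localTheta_sub hM hB η t k q).sub
        (hg.const_smul η)).integrable_norm_pow two_ne_zero) i2 hpt).trans_eq ?_
      rw [integral_add i1 (hF.const_mul _), integral_add (hu.const_mul _) (integrable_const _),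
        integral_const_mul, integral_const_mul, integral_const]
      simp [hG, integral_const_mul]
    linarith

end System.Run

namespace System

/-! ### One round of descent -/

theorem integrable_globalLoss_comp {d K : ℕ} {Ξ : Type*} {S : System d K Ξ} {L : ℝ} (hK : 0 < K)
    (hs : S.LSmooth fun _ => L) (hbelow : BddBelow (Set.range S.globalLoss)) {Ω : Type*}
    [MeasurableSpace Ω] {μ : Measure Ω} [IsFiniteMeasure μ] {θ : Ω → Param d}
    (hθ : MemLp θ 2 μ) : Integrable (fun ω => S.globalLoss (θ ω)) μ := by
  obtain ⟨c, hc⟩ := hbelow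
  have hlow : ∀ x, c ≤ S.globalLoss x := fun x => hc ⟨x, rfl⟩
  have hup : ∀ x, S.globalLoss x ≤
      S.globalLoss 0 + inner ℝ (∇ S.globalLoss 0) x + L / 2 * ‖x‖ ^ 2 := fun x => by
    simpa using le_add_inner_gradient_of_lipschitz hs.differentiable_globalLoss
      (hs.globalLoss_lipschitz hK) 0 x
  have h1 : Integrable θ μ := hθ.integrable (by norm_num)
  have hg : Integrable (fun ω => S.globalLoss 0 + inner ℝ (∇ S.globalLoss 0) (θ ω) +
      L / 2 * ‖θ ω‖ ^ 2) μ :=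
    ((integrable_const _).add (h1.const_inner _)).add
      ((hθ.integrable_norm_pow two_ne_zero).const_mul _)
  exact integrable_of_le_of_le
    (hs.differentiable_globalLoss.continuous.comp_aestronglyMeasurable hθ.1)
    (Filter.Eventually.of_forall fun ω => hlow (θ ω))
    (Filter.Eventually.of_forall fun ω => hup (θ ω)) (integrable_const c) hg

namespace Run

variable {d K : ℕ} {Ξ : Type*} {S : System d K Ξ} {Ω : Type*} {R : S.Run Ω}

/-- The effect of the local drift on the averaged gradient at local step `q`. -/
noncomputable def gradDrift (R : S.Run Ω) (η : ℝ) (t q : ℕ) (ω : Ω) : Param d :=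
  (K : ℝ)⁻¹ • ∑ k, (∇ (S.localLoss k) (R.localTheta η t k q ω) -
    ∇ (S.localLoss k) (R.theta η t ω))

theorem gradDrift_eq {Lk : Fin K → ℝ} (hs : S.LSmooth Lk) (η : ℝ) (t q : ℕ) (ω : Ω) :
    ∇ S.globalLoss (R.theta η t ω) + R.gradDrift η t q ω =
      (K : ℝ)⁻¹ • ∑ k, ∇ (S.localLoss k) (R.localTheta η t k q ω) := by
  rw [gradDrift, hs.gradient_globalLoss, ← smul_add, ← Finset.sum_add_distrib]
  simp

variable [MeasurableSpace Ω] {μ : Measure Ω} {σl : ℝ} {Bk : Fin K → ℝ}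

theorem integral_inv_mul_sum_le {g : Fin K → Ω → ℝ} (hK : 0 < K) {c : ℝ}
    (hg : ∀ k, Integrable (g k) μ) (hc : ∀ k, ∫ ω, g k ω ∂μ ≤ c) :
    ∫ ω, (K : ℝ)⁻¹ * ∑ k, g k ω ∂μ ≤ c := by
  have hK' : (0 : ℝ) < K := by exact_mod_cast hK
  rw [integral_const_mul, integral_finsetSum _ fun k _ => hg k, inv_mul_le_iff₀ hK']
  refine (Finset.sum_le_sum fun k _ => hc k).trans_eq ?_
  simp

variable [IsProbabilityMeasure μ]

theorem memLp_gradDrift (hM : R.IsModel μ) (hB : R.BoundedMoments μ σl Bk) (η : ℝ) (t q : ℕ) :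
    MemLp (R.gradDrift η t q) 2 μ :=
  (memLp_finsetSum Finset.univ fun k _ =>
    (memLp_gradient_localLoss hM hB k (measurable_localTheta hM η t k q)).sub
      (memLp_gradient_localLoss hM hB k (measurable_theta hM η t))).const_smul (K : ℝ)⁻¹

theorem integral_norm_gradDrift_sq_le {L D : ℝ} (hK : 0 < K) (hs : S.LSmooth fun _ => L)
    (hM : R.IsModel μ) (hB : R.BoundedMoments μ σl Bk) (η : ℝ) (t q : ℕ)
    (hD : ∀ k, ∫ ω, ‖R.localTheta η t k q ω - R.theta η t ω‖ ^ 2 ∂μ ≤ D) :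
    ∫ ω, ‖R.gradDrift η t q ω‖ ^ 2 ∂μ ≤ L ^ 2 * D := by
  have hi : ∀ k, Integrable (fun ω => L ^ 2 * ‖R.localTheta η t k q ω - R.theta η t ω‖ ^ 2) μ :=
    fun k => ((memLp_localTheta_sub hM hB η t k q).integrable_norm_pow two_ne_zero).const_mul _
  refine le_trans (integral_mono ((memLp_gradDrift hM hB η t q).integrable_norm_pow two_ne_zero)
    ((integrable_finsetSum Finset.univ fun k _ => hi k).const_mul (K : ℝ)⁻¹) fun ω => ?_)
    (integral_inv_mul_sum_le hK hi fun k => ?_)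
  · refine (norm_inv_smul_sum_sq_le hK _).trans ?_
    gcongr with k _
    rw [← mul_pow]
    gcongr
    exact (hs k).2 _ _
  · rw [integral_const_mul]
    exact mul_le_mul_of_nonneg_left (hD k) (sq_nonneg L)

theorem integral_norm_gradient_virtual_sub_sq_le {L M : ℝ} (hK : 0 < K)
    (hs : S.LSmooth fun _ => L) (hM : R.IsModel μ) (hB : R.BoundedMoments μ σl Bk) (η : ℝ)
    (t : ℕ) (hmem : (K : ℝ)⁻¹ * ∑ k, ∫ ω, ‖R.memory η t k ω‖ ^ 2 ∂μ ≤ M) :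
    ∫ ω, ‖∇ S.globalLoss (R.virtual η t ω) - ∇ S.globalLoss (R.theta η t ω)‖ ^ 2 ∂μ ≤
      L ^ 2 * M := by
  have hi : ∀ k, Integrable (fun ω => ‖R.memory η t k ω‖ ^ 2) μ := fun k =>
    (memLp_memory hM hB η t k).integrable_norm_pow two_ne_zero
  have hF : MemLp (fun ω => ∇ S.globalLoss (R.virtual η t ω) - ∇ S.globalLoss (R.theta η t ω))
      2 μ :=
    (memLp_gradient_globalLoss hs hM hB (measurable_virtual hM η t)).sub
      (memLp_gradient_globalLoss hs hM hB (measurable_theta hM η t))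
  calc ∫ ω, ‖∇ S.globalLoss (R.virtual η t ω) - ∇ S.globalLoss (R.theta η t ω)‖ ^ 2 ∂μ
      ≤ ∫ ω, L ^ 2 * ((K : ℝ)⁻¹ * ∑ k, ‖R.memory η t k ω‖ ^ 2) ∂μ := by
        refine integral_mono (hF.integrable_norm_pow two_ne_zero)
          (((integrable_finsetSum _ fun k _ => hi k).const_mul _).const_mul _) fun ω => ?_
        have h1 := hs.globalLoss_lipschitz hK (R.virtual η t ω) (R.theta η t ω)
        have h2 : ‖R.virtual η t ω - R.theta η t ω‖ ^ 2 ≤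
            (K : ℝ)⁻¹ * ∑ k, ‖R.memory η t k ω‖ ^ 2 := by
          rw [virtual, sub_sub_cancel_left, norm_neg]
          exact norm_inv_smul_sum_sq_le hK _
        calc _ ≤ (L * ‖R.virtual η t ω - R.theta η t ω‖) ^ 2 := by gcongr
          _ = L ^ 2 * ‖R.virtual η t ω - R.theta η t ω‖ ^ 2 := mul_pow _ _ _
          _ ≤ _ := by gcongr
    _ = L ^ 2 * ((K : ℝ)⁻¹ * ∑ k, ∫ ω, ‖R.memory η t k ω‖ ^ 2 ∂μ) := by
        rw [integral_const_mul, integral_const_mul, integral_finsetSum _ fun k _ => hi k]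
    _ ≤ L ^ 2 * M := by gcongr

/-- The first-order term of the descent inequality: independence of the mini-batches replaces the
stochastic gradients by `∇f_k` at the local iterates. -/
theorem neg_integral_inner_avgDelta_le {L M D : ℝ} (hK : 0 < K)
    (hs : S.LSmooth fun _ => L) (hM : R.IsModel μ) (hB : R.BoundedMoments μ σl Bk) {η : ℝ}
    (hη : 0 < η) (t : ℕ) (hmem : (K : ℝ)⁻¹ * ∑ k, ∫ ω, ‖R.memory η t k ω‖ ^ 2 ∂μ ≤ M)
    (hD : ∀ k, ∀ q < S.Q, ∫ ω, ‖R.localTheta η t k q ω - R.theta η t ω‖ ^ 2 ∂μ ≤ D) :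
    -∫ ω, inner ℝ (∇ S.globalLoss (R.virtual η t ω)) (R.avgDelta η t ω) ∂μ ≤
      η * S.Q * (-(1 / 4) * ∫ ω, ‖∇ S.globalLoss (R.theta η t ω)‖ ^ 2 ∂μ +
        3 / 2 * (L ^ 2 * M) + L ^ 2 * D) := by
  set W : Ω → Param d := fun ω => ∇ S.globalLoss (R.virtual η t ω) with hW
  set F : Ω → Param d := fun ω => ∇ S.globalLoss (R.theta η t ω) with hF
  have hW2 : MemLp W 2 μ := memLp_gradient_globalLoss hs hM hB (measurable_virtual hM η t)
  have hF2 : MemLp F 2 μ := memLp_gradient_globalLoss hs hM hB (measurable_theta hM η t)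
  have hWm : ∀ k q, Measurable[R.exceptBatch (t, k, q)] W := fun k q =>
    (measurable_gradient _).comp (@measurable_virtual_of d K Ξ S Ω R (R.exceptBatch (t, k, q)) η t
      (measurable_state_exceptBatch hM η t k q))
  have hloc := fun k q => memLp_gradient_localLoss hM hB k (measurable_localTheta hM η t k q)
  have i1 : ∀ k q, Integrable (fun ω => inner ℝ (W ω) (R.localGrad η t k q ω)) μ := fun k q =>
    integrable_inner_of_memLp_two hW2 (memLp_localGrad hM hB η t k q)
  have i2 : ∀ k q, Integrable (fun ω => inner ℝ (W ω)
      (∇ (S.localLoss k) (R.localTheta η t k q ω))) μ := fun k q =>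
    integrable_inner_of_memLp_two hW2 (hloc k q)
  have e1 : ∫ ω, inner ℝ (W ω) (R.avgDelta η t ω) ∂μ =
      η * ∑ q ∈ Finset.range S.Q, ∫ ω, inner ℝ (W ω) (F ω + R.gradDrift η t q ω) ∂μ := by
    simp_rw [avgDelta_eq, hF, gradDrift_eq hs, inner_smul_right, inner_sum, inner_smul_right,
      inner_sum]
    rw [integral_const_mul, integral_finsetSum _ fun q _ =>
      (integrable_finsetSum _ fun k _ => i1 k q).const_mul _]
    simp_rw [integral_const_mul]
    congr 1
    refine Finset.sum_congr rfl fun q _ => ?_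
    rw [integral_finsetSum _ fun k _ => i1 k q, integral_finsetSum _ fun k _ => i2 k q]
    congr 1
    exact Finset.sum_congr rfl fun k _ => integral_inner_localGrad hM hB η t k q (hWm k q) hW2
  have hq : ∀ q ∈ Finset.range S.Q, -∫ ω, inner ℝ (W ω) (F ω + R.gradDrift η t q ω) ∂μ ≤
      -(1 / 4) * ∫ ω, ‖F ω‖ ^ 2 ∂μ + 3 / 2 * (L ^ 2 * M) + L ^ 2 * D := fun q hq => by
    have hE := memLp_gradDrift hM hB η t q
    have j1 := hF2.integrable_norm_pow two_ne_zero
    have j2 := (hW2.sub hF2).integrable_norm_pow two_ne_zero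
    have j3 := hE.integrable_norm_pow two_ne_zero
    have j4 : Integrable (fun ω => -(1 / 4) * ‖F ω‖ ^ 2 + 3 / 2 * ‖W ω - F ω‖ ^ 2) μ :=
      (j1.const_mul _).add (j2.const_mul _)
    have h1 : ∫ ω, -inner ℝ (W ω) (F ω + R.gradDrift η t q ω) ∂μ ≤
        ∫ ω, (-(1 / 4) * ‖F ω‖ ^ 2 + 3 / 2 * ‖W ω - F ω‖ ^ 2 + ‖R.gradDrift η t q ω‖ ^ 2) ∂μ := by
      refine integral_mono (integrable_inner_of_memLp_two hW2 (hF2.add hE)).neg (j4.add j3)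
        fun ω => ?_
      have h := neg_inner_add_add_le (F ω) (W ω - F ω) (R.gradDrift η t q ω)
      rwa [add_sub_cancel] at h
    have j2' : Integrable (fun ω => ‖W ω - F ω‖ ^ 2) μ := j2
    rw [integral_neg, integral_add j4 j3, integral_add (j1.const_mul _) (j2'.const_mul _),
      integral_const_mul, integral_const_mul] at h1
    have h2 := integral_norm_gradient_virtual_sub_sq_le hK hs hM hB η t hmem
    have h3 := integral_norm_gradDrift_sq_le hK hs hM hB η t q fun k =>
      hD k q (Finset.mem_range.1 hq)
    linarith
  rw [e1, ← mul_neg, ← Finset.sum_neg_distrib, mul_assoc]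
  refine mul_le_mul_of_nonneg_left ((Finset.sum_le_sum hq).trans_eq ?_) hη.le
  rw [Finset.sum_const, Finset.card_range, nsmul_eq_mul]

/-- The second-order term of the descent inequality, with the stochastic gradients split into
gradient noise, drift and `∇f(θ^{(t)})`. -/
theorem integral_norm_avgDelta_sq_le {L D : ℝ} (hK : 0 < K)
    (hs : S.LSmooth fun _ => L) (hM : R.IsModel μ) (hB : R.BoundedMoments μ σl Bk) (η : ℝ)
    (t : ℕ) (hD : ∀ k, ∀ q < S.Q, ∫ ω, ‖R.localTheta η t k q ω - R.theta η t ω‖ ^ 2 ∂μ ≤ D) :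
    ∫ ω, ‖R.avgDelta η t ω‖ ^ 2 ∂μ ≤ 3 * η ^ 2 * S.Q ^ 2 *
      (σl ^ 2 + L ^ 2 * D + ∫ ω, ‖∇ S.globalLoss (R.theta η t ω)‖ ^ 2 ∂μ) := by
  set F : Ω → Param d := fun ω => ∇ S.globalLoss (R.theta η t ω) with hF
  have hF2 : MemLp F 2 μ := memLp_gradient_globalLoss hs hM hB (measurable_theta hM η t)
  let X : Fin K → ℕ → Ω → Param d := fun k q ω => R.localGrad η t k q ω -
    ∇ (S.localLoss k) (R.localTheta η t k q ω)
  have hX : ∀ k q, Integrable (fun ω => ‖X k q ω‖ ^ 2) μ := fun k q =>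
    ((memLp_localGrad hM hB η t k q).sub (memLp_gradient_localLoss hM hB k
      (measurable_localTheta hM η t k q))).integrable_norm_pow two_ne_zero
  have hXavg : ∀ q, Integrable (fun ω => (K : ℝ)⁻¹ * ∑ k, ‖X k q ω‖ ^ 2) μ := fun q =>
    (integrable_finsetSum _ fun k _ => hX k q).const_mul _
  have j1 := hF2.integrable_norm_pow two_ne_zero
  have j3 := fun q => (memLp_gradDrift hM hB η t q).integrable_norm_pow two_ne_zero
  have hsplit : ∀ q ω, ‖(K : ℝ)⁻¹ • ∑ k, R.localGrad η t k q ω‖ ^ 2 ≤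
      3 * ((K : ℝ)⁻¹ * ∑ k, ‖X k q ω‖ ^ 2 + ‖R.gradDrift η t q ω‖ ^ 2 + ‖F ω‖ ^ 2) := by
    intro q ω
    have e : (K : ℝ)⁻¹ • ∑ k, R.localGrad η t k q ω =
        (K : ℝ)⁻¹ • ∑ k, X k q ω + R.gradDrift η t q ω + F ω := by
      rw [add_assoc, add_comm (R.gradDrift η t q ω), hF, gradDrift_eq hs, ← smul_add,
        ← Finset.sum_add_distrib]
      simp [X]
    rw [e]
    refine (norm_add_sq_le_three _ _ _).trans ?_
    gcongr
    exact norm_inv_smul_sum_sq_le hK _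
  have j4 : ∀ q, Integrable (fun ω => (K : ℝ)⁻¹ * ∑ k, ‖X k q ω‖ ^ 2 +
      ‖R.gradDrift η t q ω‖ ^ 2) μ := fun q => (hXavg q).add (j3 q)
  have j5 : ∀ q, Integrable (fun ω => 3 * ((K : ℝ)⁻¹ * ∑ k, ‖X k q ω‖ ^ 2 +
      ‖R.gradDrift η t q ω‖ ^ 2 + ‖F ω‖ ^ 2)) μ := fun q => ((j4 q).add j1).const_mul 3
  have hq : ∀ q ∈ Finset.range S.Q, ∫ ω, 3 * ((K : ℝ)⁻¹ * ∑ k, ‖X k q ω‖ ^ 2 +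
      ‖R.gradDrift η t q ω‖ ^ 2 + ‖F ω‖ ^ 2) ∂μ ≤
      3 * (σl ^ 2 + L ^ 2 * D + ∫ ω, ‖F ω‖ ^ 2 ∂μ) := fun q hq => by
    rw [integral_const_mul, integral_add (j4 q) j1, integral_add (hXavg q) (j3 q)]
    have h2 := integral_inv_mul_sum_le hK (fun k => hX k q) fun k =>
      integral_norm_localGrad_sub_sq_le hM hB η t k q
    have h3 := integral_norm_gradDrift_sq_le hK hs hM hB η t q fun k =>
      hD k q (Finset.mem_range.1 hq)
    gcongr
  calc ∫ ω, ‖R.avgDelta η t ω‖ ^ 2 ∂μ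
      ≤ ∫ ω, η ^ 2 * (S.Q * ∑ q ∈ Finset.range S.Q, 3 * ((K : ℝ)⁻¹ * ∑ k, ‖X k q ω‖ ^ 2 +
          ‖R.gradDrift η t q ω‖ ^ 2 + ‖F ω‖ ^ 2)) ∂μ := by
        refine integral_mono ((memLp_avgDelta hM hB η t).integrable_norm_pow two_ne_zero)
          (((integrable_finsetSum _ fun q _ => j5 q).const_mul _).const_mul _) fun ω => ?_
        simp only
        rw [avgDelta_eq, norm_smul, mul_pow, Real.norm_eq_abs, sq_abs]
        have h := norm_sum_sq_le (Finset.range S.Q) fun q =>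
          (K : ℝ)⁻¹ • ∑ k, R.localGrad η t k q ω
        rw [Finset.card_range] at h
        refine mul_le_mul_of_nonneg_left (h.trans ?_) (sq_nonneg η)
        gcongr with q _
        exact hsplit q ω
    _ = η ^ 2 * (S.Q * ∑ q ∈ Finset.range S.Q, ∫ ω, 3 * ((K : ℝ)⁻¹ * ∑ k, ‖X k q ω‖ ^ 2 +
          ‖R.gradDrift η t q ω‖ ^ 2 + ‖F ω‖ ^ 2) ∂μ) := by
        rw [integral_const_mul, integral_const_mul, integral_finsetSum _ fun q _ => j5 q]
    _ ≤ η ^ 2 * (S.Q * ∑ q ∈ Finset.range S.Q,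
          3 * (σl ^ 2 + L ^ 2 * D + ∫ ω, ‖F ω‖ ^ 2 ∂μ)) := by
        gcongr with q hq'
        exact hq q hq'
    _ = _ := by
        rw [Finset.sum_const, Finset.card_range, nsmul_eq_mul]; ring

/-- The noise is centred and independent of everything else in its round. -/
theorem integral_norm_add_noise_sq (hM : R.IsModel μ) (hB : R.BoundedMoments μ σl Bk) (η : ℝ)
    (t : ℕ) (c : ℝ) :
    ∫ ω, ‖R.avgDelta η t ω + c • R.noise t ω‖ ^ 2 ∂μ =
      ∫ ω, ‖R.avgDelta η t ω‖ ^ 2 ∂μ + c ^ 2 * (d * (S.σ : ℝ) ^ 2) := by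
  have hA2 := memLp_avgDelta hM hB η t
  have hAm : ∀ j, Measurable[R.exceptNoise (t, j)] (R.avgDelta η t) := fun j => by
    have h : ∀ k, Measurable[R.exceptNoise (t, j)] (R.delta η t k) := fun k =>
      @measurable_delta_of d K Ξ S Ω R (R.exceptNoise (t, j)) η hM.batch_subset t
        (measurable_state_exceptNoise hM η t j) k fun q => measurable_batch_exceptNoise _ _ _ _
    have h' : Measurable[R.exceptNoise (t, j)] fun ω => ∑ k, R.delta η t k ω :=
      @Finset.measurable_fun_sum _ _ _ _ _ _ (R.exceptNoise (t, j)) _ _ fun k _ => h k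
    exact h'.const_smul (K : ℝ)⁻¹
  have hcross := integral_inner_noise hM t hAm hA2
  have hn := memLp_noise hM t
  have e : ∀ ω, ‖R.avgDelta η t ω + c • R.noise t ω‖ ^ 2 =
      ‖R.avgDelta η t ω‖ ^ 2 + 2 * c * inner ℝ (R.avgDelta η t ω) (R.noise t ω) +
        c ^ 2 * ‖R.noise t ω‖ ^ 2 := fun ω => by
    rw [norm_add_sq_real, inner_smul_right, norm_smul, mul_pow, Real.norm_eq_abs, sq_abs]
    ring
  have i1 := hA2.integrable_norm_pow two_ne_zero
  have i2 := integrable_inner_of_memLp_two hA2 hn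
  have i3 := hn.integrable_norm_pow two_ne_zero
  have i4 : Integrable (fun ω => ‖R.avgDelta η t ω‖ ^ 2 +
      2 * c * inner ℝ (R.avgDelta η t ω) (R.noise t ω)) μ :=
    i1.add (i2.const_mul _)
  simp_rw [e]
  rw [integral_add i4 (i3.const_mul _), integral_add i1 (i2.const_mul _), integral_const_mul,
    integral_const_mul, hcross, integral_norm_noise_sq hM]
  ring

theorem integral_globalLoss_virtual_succ_le {L : ℝ} (hK : 0 < K) (hs : S.LSmooth fun _ => L)
    (hbelow : BddBelow (Set.range S.globalLoss)) (hM : R.IsModel μ)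
    (hB : R.BoundedMoments μ σl Bk) {η : ℝ} (hη : 0 < η) (t : ℕ) (hρ : ∀ s < t + 1, 0 < R.ρ s) :
    ∫ ω, S.globalLoss (R.virtual η (t + 1) ω) ∂μ ≤
      ∫ ω, S.globalLoss (R.virtual η t ω) ∂μ -
      ∫ ω, inner ℝ (∇ S.globalLoss (R.virtual η t ω)) (R.avgDelta η t ω) ∂μ +
      L / 2 * (∫ ω, ‖R.avgDelta η t ω‖ ^ 2 ∂μ +
        η ^ 2 * (S.σ : ℝ) ^ 2 / K ^ 2 * (d / R.ρ t)) := by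
  have hρt := hρ t (by omega)
  set c : ℝ := η / (√(R.ρ t) * K) with hc
  have hA2 := memLp_avgDelta hM hB η t
  have hW2 : MemLp (fun ω => ∇ S.globalLoss (R.virtual η t ω)) 2 μ :=
    memLp_gradient_globalLoss hs hM hB (measurable_virtual hM η t)
  have hWm : ∀ j, Measurable[R.exceptNoise (t, j)]
      fun ω => ∇ S.globalLoss (R.virtual η t ω) := fun j =>
    (measurable_gradient _).comp (@measurable_virtual_of d K Ξ S Ω R (R.exceptNoise (t, j)) η t
      (measurable_state_exceptNoise hM η t j))
  have hn := memLp_noise hM t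
  have hpt : ∀ ω, S.globalLoss (R.virtual η (t + 1) ω) ≤ S.globalLoss (R.virtual η t ω) -
      inner ℝ (∇ S.globalLoss (R.virtual η t ω)) (R.avgDelta η t ω) -
      c * inner ℝ (∇ S.globalLoss (R.virtual η t ω)) (R.noise t ω) +
      L / 2 * ‖R.avgDelta η t ω + c • R.noise t ω‖ ^ 2 := fun ω => by
    have h := le_add_inner_gradient_of_lipschitz hs.differentiable_globalLoss
      (hs.globalLoss_lipschitz hK) (R.virtual η t ω) (-(R.avgDelta η t ω + c • R.noise t ω))
    rw [R.virtual_succ hη hρt ω]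
    rw [inner_neg_right, inner_add_right, inner_smul_right (∇ S.globalLoss (R.virtual η t ω))
      (R.noise t ω) c, norm_neg] at h
    linarith
  have i0 := integrable_globalLoss_comp hK hs hbelow
    (memLp_virtual hM hB hη t fun s hs => hρ s (by omega))
  have i0' := integrable_globalLoss_comp hK hs hbelow (memLp_virtual hM hB hη (t + 1) hρ)
  have i1 := integrable_inner_of_memLp_two hW2 hA2
  have i2 := integrable_inner_of_memLp_two hW2 hn
  have i3 : Integrable (fun ω => ‖R.avgDelta η t ω + c • R.noise t ω‖ ^ 2) μ :=
    (hA2.add (hn.const_smul c)).integrable_norm_pow two_ne_zero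
  have i4 : Integrable (fun ω => S.globalLoss (R.virtual η t ω) -
      inner ℝ (∇ S.globalLoss (R.virtual η t ω)) (R.avgDelta η t ω)) μ :=
    i0.sub i1
  have i5 : Integrable (fun ω => S.globalLoss (R.virtual η t ω) -
      inner ℝ (∇ S.globalLoss (R.virtual η t ω)) (R.avgDelta η t ω) -
      c * inner ℝ (∇ S.globalLoss (R.virtual η t ω)) (R.noise t ω)) μ := i4.sub (i2.const_mul c)
  have h := integral_mono i0' (i5.add (i3.const_mul (L / 2))) hpt
  refine h.trans_eq ?_
  have hnoise := integral_norm_add_noise_sq hM hB η t c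
  have e : ∫ ω, (S.globalLoss (R.virtual η t ω) -
      inner ℝ (∇ S.globalLoss (R.virtual η t ω)) (R.avgDelta η t ω) -
      c * inner ℝ (∇ S.globalLoss (R.virtual η t ω)) (R.noise t ω) +
      L / 2 * ‖R.avgDelta η t ω + c • R.noise t ω‖ ^ 2) ∂μ =
      ∫ ω, S.globalLoss (R.virtual η t ω) ∂μ -
      ∫ ω, inner ℝ (∇ S.globalLoss (R.virtual η t ω)) (R.avgDelta η t ω) ∂μ +
      L / 2 * (∫ ω, ‖R.avgDelta η t ω‖ ^ 2 ∂μ + c ^ 2 * (d * (S.σ : ℝ) ^ 2)) := by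
    rw [integral_add i5 (i3.const_mul _), integral_sub i4 (i2.const_mul _), integral_sub i0 i1,
      integral_const_mul, integral_const_mul, integral_inner_noise hM t hWm hW2, hnoise]
    ring
  refine Eq.trans e ?_
  have hc2 : c ^ 2 = η ^ 2 / (R.ρ t * K ^ 2) := by
    rw [hc, div_pow, mul_pow, Real.sq_sqrt hρt.le]
  rw [hc2]
  congr 3
  field_simp

/-- One round decreases the expected loss at the virtual model, up to the memory term `M`, the
channel noise term `N`, the heterogeneity and the gradient noise. -/
theorem descent_step {L σg M N : ℝ} (hd : 0 < d) (hK : 0 < K) (hQ : 0 < S.Q)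
    (hs : S.LSmooth fun _ => L) (hhet : S.BoundedHeterogeneity σg)
    (hbelow : BddBelow (Set.range S.globalLoss)) (hM : R.IsModel μ)
    (hB : R.BoundedMoments μ σl Bk) {η : ℝ} (hη : 0 < η) (hstep : StepSizeCondition η L S.Q)
    (t : ℕ) (hρ : ∀ s < t + 1, 0 < R.ρ s)
    (hmem : (K : ℝ)⁻¹ * ∑ k, ∫ ω, ‖R.memory η t k ω‖ ^ 2 ∂μ ≤ M)
    (hN : d / R.ρ t ≤ 2 * S.Q * N) :
    ∫ ω, S.globalLoss (R.virtual η (t + 1) ω) ∂μ ≤ ∫ ω, S.globalLoss (R.virtual η t ω) ∂μ -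
      η * S.Q / 8 * ∫ ω, ‖∇ S.globalLoss (R.theta η t ω)‖ ^ 2 ∂μ +
      η * S.Q / 8 * (12 * L ^ 2 * M + 8 * η * L * (S.σ : ℝ) ^ 2 / K ^ 2 * N +
        ((40 * η ^ 2 * S.Q * L ^ 2 + 60 * η ^ 3 * S.Q ^ 2 * L ^ 3) * (σl ^ 2 + 6 * S.Q * σg ^ 2) +
          12 * η * S.Q * L * σl ^ 2)) := by
  have hL : 0 ≤ L := hs.nonneg hd ⟨0, hK⟩
  unfold StepSizeCondition at hstep
  set G : ℝ := ∫ ω, ‖∇ S.globalLoss (R.theta η t ω)‖ ^ 2 ∂μ with hG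
  have hG0 : 0 ≤ G := integral_nonneg fun ω => sq_nonneg _
  have hηL : η * S.Q * L ≤ 1 / 12 := by
    have h1 : 0 ≤ 45 * η ^ 3 * L ^ 3 * (S.Q : ℝ) ^ 3 := by positivity
    have h2 : 0 ≤ 30 * η ^ 2 * (S.Q : ℝ) ^ 2 * L ^ 2 := by positivity
    linarith
  set D : ℝ := 5 * S.Q * η ^ 2 * (σl ^ 2 + 6 * S.Q * σg ^ 2) + 30 * S.Q ^ 2 * η ^ 2 * G with hD
  have hdrift : ∀ k, ∀ q < S.Q,
      ∫ ω, ‖R.localTheta η t k q ω - R.theta η t ω‖ ^ 2 ∂μ ≤ D := fun k q hq =>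
    integral_norm_localTheta_sub_sq_le hs hL hhet hQ hM hB hη hηL t k hq.le
  have h1 := integral_globalLoss_virtual_succ_le hK hs hbelow hM hB hη t hρ
  have h2 := neg_integral_inner_avgDelta_le hK hs hM hB hη t hmem hdrift
  have h3 := mul_le_mul_of_nonneg_left (integral_norm_avgDelta_sq_le hK hs hM hB η t hdrift)
    (show 0 ≤ L / 2 by positivity)
  have h4 := mul_le_mul_of_nonneg_left hN
    (show 0 ≤ L / 2 * (η ^ 2 * (S.σ : ℝ) ^ 2 / K ^ 2) by positivity)
  -- the step size condition absorbs the multiples of `G` coming from the drift and from the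
  -- second-order term
  have h5 := mul_le_mul_of_nonneg_left hstep (show 0 ≤ η * S.Q * G by positivity)
  rw [← hG] at h2 h3
  rw [hD] at h2 h3
  have e : L / 2 * (η ^ 2 * (S.σ : ℝ) ^ 2 / K ^ 2) * (2 * S.Q * N) =
      η * S.Q / 8 * (8 * η * L * (S.σ : ℝ) ^ 2 / K ^ 2 * N) := by ring
  rw [e] at h4
  linarith

end Run

end System

/-! ### The convergence bound -/

namespace System

variable {d K : ℕ} {Ξ : Type*} {S : System d K Ξ}

theorem Run.PowerControl.rho_pos {Ω : Type*} [MeasurableSpace Ω] {μ : Measure Ω} {R : S.Run Ω}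
    {η : ℝ} {T : ℕ} (h : R.PowerControl μ η T) : ∀ s < T, 0 < R.ρ s :=
  fun s hs => (h s hs).1.1

theorem Run.BoundedMoments.mono {Ω : Type*} [MeasurableSpace Ω] {μ : Measure Ω} {R : S.Run Ω}
    {σl B : ℝ} {Bk : Fin K → ℝ} (h : R.BoundedMoments μ σl Bk) (h0 : ∀ k, 0 ≤ Bk k)
    (hB : ∀ k, Bk k ≤ B) : R.BoundedMoments μ σl fun _ => B := fun t k q θ =>
  ⟨(h t k q θ).1, (h t k q θ).2.1, (h t k q θ).2.2.trans (pow_le_pow_left₀ (h0 k) (hB k) 2)⟩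

/-- The channel noise constant `max_k λ_k B² Q (C_{λ_k} + 1) / (P_k κ_k ε_k)`. -/
noncomputable def noiseConst (S : System d K Ξ) (B : ℝ) : ℝ :=
  ⨆ k, S.transProb k * B ^ 2 * S.Q * (contractionConst (S.transProb k) + 1) /
    (S.P k * S.κ k * S.ε k)

theorem noiseConst_nonneg (S : System d K Ξ) (htrans : ∀ k, 0 < S.transProb k) (B : ℝ) :
    0 ≤ S.noiseConst B :=
  Real.iSup_nonneg fun k => by
    have h0 := htrans k
    have h1 := contractionConst_nonneg h0 (S.transProb_le_one k)
    have h2 := S.P_pos k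
    have h3 := S.κ_pos k
    have h4 := S.ε_pos k
    positivity

/-- The terms of the bound that, at a fixed step size, do not vanish as the number of rounds
grows. -/
noncomputable def residual (S : System d K Ξ) (η L B σl σg : ℝ) : ℝ :=
  12 / K * ∑ k, η ^ 2 * B ^ 2 * S.Q ^ 2 * L ^ 2 * contractionConst (S.transProb k) +
  8 * η * L * (S.σ : ℝ) ^ 2 / K ^ 2 * S.noiseConst B +
  ((40 * η ^ 2 * S.Q * L ^ 2 + 60 * η ^ 3 * S.Q ^ 2 * L ^ 3) * (σl ^ 2 + 6 * S.Q * σg ^ 2) +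
    12 * η * S.Q * L * σl ^ 2)

/-- The telescoped descent inequality. -/
theorem Run.avgSqGrad_le {Ω : Type*} [MeasurableSpace Ω] {μ : Measure Ω} [IsProbabilityMeasure μ]
    {R : S.Run Ω} {L B σl σg : ℝ} (hd : 0 < d) (hK : 0 < K) (hQ : 0 < S.Q)
    (hs : S.LSmooth fun _ => L) (hhet : S.BoundedHeterogeneity σg)
    (htrans : ∀ k, 0 < S.transProb k) (hbelow : BddBelow (Set.range S.globalLoss))
    (hM : R.IsModel μ) (hB : R.BoundedMoments μ σl fun _ => B) {η : ℝ} (hη : 0 < η)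
    (hstep : StepSizeCondition η L S.Q) {T : ℕ} (hT : 0 < T) (hP : R.PowerControl μ η T) :
    R.avgSqGrad μ η T ≤ 8 / (η * S.Q * T) * (S.globalLoss S.θ₀ - ⨅ θ, S.globalLoss θ) +
      S.residual η L B σl σg := by
  have hK' : (0 : ℝ) < K := by exact_mod_cast hK
  have hQ' : (0 : ℝ) < S.Q := by exact_mod_cast hQ
  have hT' : (0 : ℝ) < T := by exact_mod_cast hT
  set M : ℝ := (K : ℝ)⁻¹ * ∑ k, contractionConst (S.transProb k) * (η * S.Q * B) ^ 2 with hMdef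
  have hres : S.residual η L B σl σg = 12 * L ^ 2 * M +
      8 * η * L * (S.σ : ℝ) ^ 2 / K ^ 2 * S.noiseConst B +
      ((40 * η ^ 2 * S.Q * L ^ 2 + 60 * η ^ 3 * S.Q ^ 2 * L ^ 3) * (σl ^ 2 + 6 * S.Q * σg ^ 2) +
        12 * η * S.Q * L * σl ^ 2) := by
    rw [residual, hMdef]
    congr 2
    rw [Finset.mul_sum, Finset.mul_sum, Finset.mul_sum]
    exact Finset.sum_congr rfl fun k _ => by ring
  set G : ℕ → ℝ := fun t => ∫ ω, ‖∇ S.globalLoss (R.theta η t ω)‖ ^ 2 ∂μ with hG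
  set V : ℕ → ℝ := fun t => ∫ ω, S.globalLoss (R.virtual η t ω) ∂μ with hV
  have hround : ∀ t ∈ Finset.range T,
      η * S.Q / 8 * G t ≤ V t - V (t + 1) + η * S.Q / 8 * S.residual η L B σl σg := by
    intro t ht
    have ht' := Finset.mem_range.1 ht
    obtain ⟨k, hk⟩ := exists_div_rho_le hM hB hη hd hK htrans (hP t ht')
    have hN : d / R.ρ t ≤ 2 * S.Q * S.noiseConst B :=
      hk.trans (mul_le_mul_of_nonneg_left (le_ciSup (Finite.bddAbove_range fun k =>
        S.transProb k * B ^ 2 * S.Q * (contractionConst (S.transProb k) + 1) /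
          (S.P k * S.κ k * S.ε k)) k) (by positivity))
    have hmem : (K : ℝ)⁻¹ * ∑ k, ∫ ω, ‖R.memory η t k ω‖ ^ 2 ∂μ ≤ M := by
      rw [hMdef]
      gcongr with k _
      exact integral_norm_memory_sq_le hM hB η (htrans k) t
    have h := descent_step hd hK hQ hs hhet hbelow hM hB hη hstep t
      (fun s hs => hP.rho_pos s (by omega)) hmem hN
    rw [← hres] at h
    linarith
  have hsum := Finset.sum_le_sum hround
  rw [← Finset.mul_sum, Finset.sum_add_distrib, Finset.sum_range_sub', Finset.sum_const,
    Finset.card_range, nsmul_eq_mul] at hsum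
  have hV0 : V 0 = S.globalLoss S.θ₀ := by simp [hV, virtual_zero]
  have hVT : ⨅ θ, S.globalLoss θ ≤ V T := by
    have h := integral_mono (integrable_const (⨅ θ, S.globalLoss θ))
      (integrable_globalLoss_comp hK hs hbelow (memLp_virtual hM hB hη T hP.rho_pos))
      fun ω => ciInf_le hbelow (R.virtual η T ω)
    simpa using h
  rw [hV0] at hsum
  have hfin : η * S.Q / 8 * ∑ t ∈ Finset.range T, G t ≤
      (S.globalLoss S.θ₀ - ⨅ θ, S.globalLoss θ) +
        T * (η * S.Q / 8 * S.residual η L B σl σg) := by linarith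
  have e : R.avgSqGrad μ η T = 8 / (η * S.Q * T) * (η * S.Q / 8 * ∑ t ∈ Finset.range T, G t) := by
    change (T : ℝ)⁻¹ * ∑ t ∈ Finset.range T, G t = _
    field_simp
  rw [e]
  refine (mul_le_mul_of_nonneg_left hfin (by positivity)).trans_eq ?_
  field_simp

/-- With `η ≤ 1`, the residual is at most linear in `η`. -/
theorem residual_le (S : System d K Ξ) (htrans : ∀ k, 0 < S.transProb k) {η L : ℝ} (B σl σg : ℝ)
    (hη : 0 ≤ η) (hη1 : η ≤ 1) (hL : 0 ≤ L) :
    S.residual η L B σl σg ≤ η * S.residual 1 L B σl σg := by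
  have h2 : η ^ 2 ≤ η := pow_le_of_le_one hη hη1 two_ne_zero
  have h3 : η ^ 3 ≤ η := pow_le_of_le_one hη hη1 three_ne_zero
  have hN := S.noiseConst_nonneg htrans B
  have hc : ∀ k, 0 ≤ contractionConst (S.transProb k) := fun k =>
    contractionConst_nonneg (htrans k) (S.transProb_le_one k)
  calc S.residual η L B σl σg
      ≤ 12 / K * ∑ k, η * B ^ 2 * S.Q ^ 2 * L ^ 2 * contractionConst (S.transProb k) +
        8 * η * L * (S.σ : ℝ) ^ 2 / K ^ 2 * S.noiseConst B +
        ((40 * η * S.Q * L ^ 2 + 60 * η * S.Q ^ 2 * L ^ 3) * (σl ^ 2 + 6 * S.Q * σg ^ 2) +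
          12 * η * S.Q * L * σl ^ 2) := by
        unfold residual
        gcongr with k _
        exact hc k
    _ = η * S.residual 1 L B σl σg := by
        have e : ∑ k, η * B ^ 2 * S.Q ^ 2 * L ^ 2 * contractionConst (S.transProb k) =
            η * ∑ k, 1 ^ 2 * B ^ 2 * S.Q ^ 2 * L ^ 2 * contractionConst (S.transProb k) := by
          rw [Finset.mul_sum]
          exact Finset.sum_congr rfl fun k _ => by ring
        unfold residual
        rw [e]
        ring

end System

theorem stepSizeCondition_of_le {η L : ℝ} {Q : ℕ} (hη : 0 ≤ η) (hη1 : η ≤ 1) (hL : 0 ≤ L)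
    (h : η * (45 * L ^ 3 * Q ^ 3 + 30 * Q ^ 2 * L ^ 2 + 3 / 2 * Q * L) ≤ 1 / 8) :
    StepSizeCondition η L Q := by
  have h2 : η ^ 2 ≤ η := pow_le_of_le_one hη hη1 two_ne_zero
  have h3 : η ^ 3 ≤ η := pow_le_of_le_one hη hη1 three_ne_zero
  unfold StepSizeCondition
  calc 45 * η ^ 3 * L ^ 3 * Q ^ 3 + 30 * η ^ 2 * Q ^ 2 * L ^ 2 + 3 / 2 * η * Q * L
      ≤ 45 * η * L ^ 3 * Q ^ 3 + 30 * η * Q ^ 2 * L ^ 2 + 3 / 2 * η * Q * L := by gcongr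
    _ = η * (45 * L ^ 3 * Q ^ 3 + 30 * Q ^ 2 * L ^ 2 + 3 / 2 * Q * L) := by ring
    _ ≤ 1 / 8 := h

end AirFL

theorem mainTheorem1 {d K : ℕ} {Ξ : Type*} (S : AirFL.System d K Ξ)
    (hd : 0 < d) (hK : 0 < K) (hQ : 0 < S.Q)
    (Lk Bk : Fin K → ℝ) (σl σg : ℝ) (hBk : ∀ k, 0 ≤ Bk k)
    (hsmooth : S.LSmooth Lk) (hhet : S.BoundedHeterogeneity σg)
    (htrans : ∀ k, 0 < S.transProb k)
    (hbelow : BddBelow (Set.range S.globalLoss))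
    (L B : ℝ) (hL : L = ⨆ k, Lk k) (hB : B = ⨆ k, Bk k) :
    (∀ (η : ℝ), 0 < η → AirFL.StepSizeCondition η L S.Q →
      ∀ (T : ℕ), 0 < T →
      ∀ (Ω : Type*) [MeasurableSpace Ω] (μ : MeasureTheory.Measure Ω)
        [MeasureTheory.IsProbabilityMeasure μ] (R : S.Run Ω),
        R.IsModel μ → R.BoundedMoments μ σl Bk → R.PowerControl μ η T →
        (∀ t < T, MeasureTheory.Integrable
          (fun ω => ‖gradient S.globalLoss (R.theta η t ω)‖ ^ 2) μ) ∧
        R.avgSqGrad μ η T ≤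
          8 / (η * S.Q * T) * (S.globalLoss S.θ₀ - ⨅ θ, S.globalLoss θ)
          + 12 / K * ∑ k, η ^ 2 * B ^ 2 * S.Q ^ 2 * L ^ 2 *
              AirFL.contractionConst (S.transProb k)
          + 8 * η * L * (S.σ : ℝ) ^ 2 / K ^ 2 *
              (⨆ k, S.transProb k * B ^ 2 * S.Q * (AirFL.contractionConst (S.transProb k) + 1) /
                (S.P k * S.κ k * S.ε k))
          + ((40 * η ^ 2 * S.Q * L ^ 2 + 60 * η ^ 3 * S.Q ^ 2 * L ^ 3) *
                (σl ^ 2 + 6 * S.Q * σg ^ 2)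
              + 12 * η * S.Q * L * σl ^ 2)) ∧
    (∃ (C : ℝ) (T₀ : ℕ), ∀ T : ℕ, T₀ ≤ T → 0 < T →
      AirFL.StepSizeCondition (1 / √(T : ℝ)) L S.Q ∧
      ∀ (Ω : Type*) [MeasurableSpace Ω] (μ : MeasureTheory.Measure Ω)
        [MeasureTheory.IsProbabilityMeasure μ] (R : S.Run Ω),
        R.IsModel μ → R.BoundedMoments μ σl Bk → R.PowerControl μ (1 / √(T : ℝ)) T →
        R.avgSqGrad μ (1 / √(T : ℝ)) T ≤ C / √(T : ℝ)) := by
  have hs : S.LSmooth fun _ => L := hL ▸ hsmooth.mono_iSup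
  have hL0 : 0 ≤ L := hs.nonneg hd ⟨0, hK⟩
  have hBle : ∀ k, Bk k ≤ B := fun k => hB ▸ le_ciSup (Finite.bddAbove_range Bk) k
  refine ⟨fun η hη hstep T hT Ω _ μ _ R hM hmom hP => ⟨fun t _ => ?_, ?_⟩, ?_⟩
  · exact (AirFL.System.Run.memLp_gradient_globalLoss hs hM hmom
      (AirFL.System.Run.measurable_theta hM η t)).integrable_norm_pow two_ne_zero
  · refine (AirFL.System.Run.avgSqGrad_le hd hK hQ hs hhet htrans hbelow hM
      (hmom.mono hBk hBle) hη hstep hT hP).trans_eq ?_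
    unfold AirFL.System.residual AirFL.System.noiseConst
    ring
  · set a : ℝ := 45 * L ^ 3 * S.Q ^ 3 + 30 * S.Q ^ 2 * L ^ 2 + 3 / 2 * S.Q * L with ha
    have ha0 : 0 ≤ a := by positivity
    -- `√T ≥ 8 a` makes the step size condition hold, since its left side is at most `a / √T`
    refine ⟨8 / S.Q * (S.globalLoss S.θ₀ - ⨅ θ, S.globalLoss θ) + S.residual 1 L B σl σg,
      ⌈(8 * a) ^ 2⌉₊, fun T hT₀ hT => ?_⟩
    have hT' : (1 : ℝ) ≤ T := by exact_mod_cast hT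
    have hQ' : (0 : ℝ) < S.Q := by exact_mod_cast hQ
    have hsq : 1 ≤ √(T : ℝ) := Real.one_le_sqrt.2 hT'
    have hpos : 0 < √(T : ℝ) := by linarith
    have hη : 0 < 1 / √(T : ℝ) := by positivity
    have hη1 : 1 / √(T : ℝ) ≤ 1 := (div_le_one hpos).2 hsq
    have hroot : 8 * a ≤ √(T : ℝ) :=
      Real.le_sqrt_of_sq_le ((Nat.le_ceil _).trans (by exact_mod_cast hT₀))
    have hstep : AirFL.StepSizeCondition (1 / √(T : ℝ)) L S.Q :=
      AirFL.stepSizeCondition_of_le hη.le hη1 hL0 (by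
        rw [← ha, one_div, inv_mul_le_iff₀ hpos]
        linarith)
    refine ⟨hstep, fun Ω _ μ _ R hM hmom hP => ?_⟩
    have h := AirFL.System.Run.avgSqGrad_le hd hK hQ hs hhet htrans hbelow hM
      (hmom.mono hBk hBle) hη hstep hT hP
    have hres := S.residual_le htrans B σl σg hη.le hη1 hL0
    have e : 8 / (1 / √(T : ℝ) * S.Q * T) = 8 / S.Q / √(T : ℝ) := by
      have hTT : (T : ℝ) = √(T : ℝ) * √(T : ℝ) := (Real.mul_self_sqrt (by linarith)).symm
      conv_lhs => rw [show 1 / √(T : ℝ) * S.Q * T = 1 / √(T : ℝ) * S.Q * (√(T : ℝ) * √(T : ℝ)) by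
        rw [← hTT]]
      field_simp
    rw [e] at h
    refine h.trans ((add_le_add_right hres _).trans_eq ?_)
    ring
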